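/- Let $K$ be a field of characteristic $0$, let $\alpha,\beta\in K$, and suppose that the polynomial $t^2-\alpha t-\beta$ has its two roots $r_1,r_2$ (counted with multiplicity) in $K$. Let $A=A(\alpha,\beta,0)$ be the down-up algebra, i.e. the quotient of the free algebra $K\langle u,d\rangle$ by the relations $$d^2u=\alpha\,dud+\beta\,ud^2,\qquad du^2=\alpha\,udu+\beta\,u^2d .$$ Assume that $A$ belongs to the family (F1) of graded generic down-up algebras: $r_1$ and $r_2$ are nonzero and $r_1^i r_2^j\neq 1$ for all integers $i,j$ with $(i,j)\neq(0,0)$. Put $w_1=\beta\,ud+r_1\,du$. Let $V$, $R$, $\Omega$ be the vector spaces with bases $\{d,u\}$, $\{d^2u,du^2\}$, $\{d^2u^2\}$, and let $\delta_0:A\otimes A\to A$ be the multiplication. Then the complex of $A$-bimodules $$0\to A\otimes\Omega\otimes A\xrightarrow{\delta_3}A\otimes R\otimes A\xrightarrow{\delta_2}A\otimes V\otimes A\xrightarrow{\delta_1}A\otimes A\to 0,$$ $$\delta_1(1\otimes v\otimes 1)=v\otimes 1-1\otimes v\quad(v\in V),$$ $$\begin{aligned}\delta_2(1\otimes d^2u\otimes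 1)={}&1\otimes d\otimes du+d\otimes d\otimes u+d^2\otimes u\otimes 1-\alpha(1\otimes d\otimes ud+d\otimes u\otimes d+du\otimes d\otimes 1)\\&-\beta(1\otimes u\otimes d^2+u\otimes d\otimes d+ud\otimes d\otimes 1),\\ \delta_2(1\otimes du^2\otimes 1)={}&1\otimes d\otimes u^2+d\otimes u\otimes u+du\otimes u\otimes 1-\alpha(1\otimes u\otimes du+u\otimes d\otimes u+ud\otimes u\otimes 1)\\&-\beta(1\otimes u\otimes ud+u\otimes u\otimes d+u^2\otimes d\otimes 1),\\ \delta_3(1\otimes d^2u^2\otimes 1)={}&d\otimes du^2\otimes 1+\beta\,1\otimes du^2\otimes d-1\otimes d^2u\otimes u-\beta\,u\otimes d^2u\otimes 1,\end{aligned}$$ is a projective resolution of $A$ via $\delta_0$. For $a\in A$ let $D^2U^2|a$ be the $3$-cocycle given by the bimodule map $A\otimes\Omega\otimes A\to A$ with $1\otimes d^2u^2\otimes 1\mapsto a$, and consider its class in the Hochschild cohomology $HH^3(A)=\mathrm{Ext}^3_{A\otimes A^{op}}(A,A)$. Then sending the residue class of $a$ to the class of $D^2U^2|a$ is a well-defined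 $K$-linear isomorphism $$A/\{da+\beta ad+a'u+\beta ua' : a,a'\in A\}\;\cong\;HH^3(A),$$ and the classes of $D^2U^2|w_1^j$ for $j\geq 0$, $j\neq 2$, together with the class of $D^2U^2|uw_1d$, form a basis of $HH^3(A)$. -/

import Mathlib

open CategoryTheory
open scoped TensorProduct
open MulOpposite (op)

universe u

/-- The enveloping algebra `A ⊗ Aᵒᵖ` of a `K`-algebra `A`. -/
abbrev EnvelopingAlgebra (K A : Type u) [Field K] [Ring A] [Algebra K A] : Type u :=
  A ⊗[K] Aᵐᵒᵖ

/-- The regular bimodule `A`, a left module over the enveloping algebra: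
`(x ⊗ op y) • a = x * a * y`. -/
noncomputable def regularBimodule (K A : Type u) [Field K] [Ring A] [Algebra K A] :
    ModuleCat.{u} (EnvelopingAlgebra K A) :=
  letI : Module (EnvelopingAlgebra K A) A := instModuleTensorProductMop K A
  ModuleCat.of (EnvelopingAlgebra K A) A

/-- The `A`-bimodule map `A ⊗ A → A` sending `1 ⊗ 1` to `a`. -/
noncomputable def bimoduleHomOfElem (K : Type u) {A : Type u} [Field K] [Ring A] [Algebra K A]
    (a : A) :
    ModuleCat.of (EnvelopingAlgebra K A) (EnvelopingAlgebra K A) ⟶ regularBimodule K A :=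
  letI : Module (EnvelopingAlgebra K A) A := instModuleTensorProductMop K A
  ModuleCat.ofHom (LinearMap.toSpanSingleton (EnvelopingAlgebra K A) A a)

/-- Hochschild cohomology `HHⁿ(A) = Extⁿ(A, A)`, with `Ext` taken over the enveloping algebra. -/
abbrev HochschildCohomology (K A : Type u) [Field K] [Ring A] [Algebra K A] (n : ℕ) : Type u :=
  Abelian.Ext.{u} (regularBimodule K A) (regularBimodule K A) n

/-- The two generators of a down-up algebra; they are also the basis of the space `V`. -/
inductive DownUpGen : Type
  | u
  | d
  deriving DecidableEq

instance : Fintype DownUpGen :=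
  ⟨{.u, .d}, by rintro (_ | _) <;> simp⟩

/-- The words `d²u` and `du²`, the basis of the space `R`. -/
inductive DownUpRelWord : Type
  | ddu
  | duu
  deriving DecidableEq

instance : Fintype DownUpRelWord :=
  ⟨{.ddu, .duu}, by rintro (_ | _) <;> simp⟩

/-- The defining relations of the down-up algebra `A(α, β, γ)`. -/
inductive DownUpRel {K : Type u} [Field K] (α β γ : K) :
    FreeAlgebra K DownUpGen → FreeAlgebra K DownUpGen → Prop
  | ddu : DownUpRel α β γ
      (FreeAlgebra.ι K .d * FreeAlgebra.ι K .d * FreeAlgebra.ι K .u)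
      (α • (FreeAlgebra.ι K .d * FreeAlgebra.ι K .u * FreeAlgebra.ι K .d)
        + β • (FreeAlgebra.ι K .u * FreeAlgebra.ι K .d * FreeAlgebra.ι K .d)
        + γ • FreeAlgebra.ι K .d)
  | duu : DownUpRel α β γ
      (FreeAlgebra.ι K .d * FreeAlgebra.ι K .u * FreeAlgebra.ι K .u)
      (α • (FreeAlgebra.ι K .u * FreeAlgebra.ι K .d * FreeAlgebra.ι K .u)
        + β • (FreeAlgebra.ι K .u * FreeAlgebra.ι K .u * FreeAlgebra.ι K .d)
        + γ • FreeAlgebra.ι K .u)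

/-- The down-up algebra `A(α, β, γ)`. -/
def DownUpAlgebra {K : Type u} [Field K] (α β γ : K) : Type u :=
  RingQuot (DownUpRel α β γ)

namespace DownUpAlgebra

variable {K : Type u} [Field K]

noncomputable instance (α β γ : K) : Ring (DownUpAlgebra α β γ) :=
  inferInstanceAs (Ring (RingQuot (DownUpRel α β γ)))

noncomputable instance (α β γ : K) : Algebra K (DownUpAlgebra α β γ) :=
  inferInstanceAs (Algebra K (RingQuot (DownUpRel α β γ)))

/-- The class of a generator. -/
noncomputable def gen (α β γ : K) (v : DownUpGen) : DownUpAlgebra α β γ :=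
  RingQuot.mkAlgHom K (DownUpRel α β γ) (FreeAlgebra.ι K v)

/-- The generator `u`. -/
noncomputable abbrev u (α β γ : K) : DownUpAlgebra α β γ := gen α β γ .u

/-- The generator `d`. -/
noncomputable abbrev d (α β γ : K) : DownUpAlgebra α β γ := gen α β γ .d

theorem ddu_eq (α β γ : K) :
    d α β γ * d α β γ * u α β γ = α • (d α β γ * u α β γ * d α β γ)
      + β • (u α β γ * d α β γ * d α β γ) + γ • d α β γ := by
  have h := RingQuot.mkAlgHom_rel K (DownUpRel.ddu (α := α) (β := β) (γ := γ))
  simp only [map_add, map_mul, map_smul] at h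
  exact h

theorem duu_eq (α β γ : K) :
    d α β γ * u α β γ * u α β γ = α • (u α β γ * d α β γ * u α β γ)
      + β • (u α β γ * u α β γ * d α β γ) + γ • u α β γ := by
  have h := RingQuot.mkAlgHom_rel K (DownUpRel.duu (α := α) (β := β) (γ := γ))
  simp only [map_add, map_mul, map_smul] at h
  exact h

/-- The element `w = β ud + r du` of `A(α, β, 0)`, for `r` a root of `t² - αt - β`. -/
noncomputable def w (α β r : K) : DownUpAlgebra α β 0 :=
  β • (u α β 0 * d α β 0) + r • (d α β 0 * u α β 0)

/-- The enveloping algebra of `A = A(α, β, 0)`. -/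
abbrev Env (α β : K) : Type u := EnvelopingAlgebra K (DownUpAlgebra α β 0)

/-- The element `x ⊗ v ⊗ y` of `A ⊗ W ⊗ A`, where `W` is a vector space with basis `ι` and `v : ι`.
The bimodule `A ⊗ W ⊗ A` is the free `A ⊗ Aᵒᵖ`-module `ι → A ⊗ Aᵒᵖ`. -/
noncomputable def tri {α β : K} {ι : Type} [DecidableEq ι]
    (x : DownUpAlgebra α β 0) (v : ι) (y : DownUpAlgebra α β 0) : ι → Env α β :=
  Pi.single v (x ⊗ₜ[K] op y)

/-- `δ₁ : A ⊗ V ⊗ A → A ⊗ A`, `1 ⊗ v ⊗ 1 ↦ v ⊗ 1 - 1 ⊗ v`. -/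
noncomputable def delta1 (α β : K) : (DownUpGen → Env α β) →ₗ[Env α β] Env α β :=
  Fintype.linearCombination (Env α β) fun v =>
    gen α β 0 v ⊗ₜ[K] op (1 : DownUpAlgebra α β 0) - (1 : DownUpAlgebra α β 0) ⊗ₜ[K] op (gen α β 0 v)

/-- The images of `1 ⊗ d²u ⊗ 1` and `1 ⊗ du² ⊗ 1` under `δ₂`. -/
noncomputable def delta2Gen (α β : K) : DownUpRelWord → DownUpGen → Env α β
  | .ddu =>
      (tri 1 .d (d α β 0 * u α β 0) + tri (d α β 0) .d (u α β 0)
          + tri (d α β 0 * d α β 0) .u 1)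
        - α • (tri 1 .d (u α β 0 * d α β 0) + tri (d α β 0) .u (d α β 0)
          + tri (d α β 0 * u α β 0) .d 1)
        - β • (tri 1 .u (d α β 0 * d α β 0) + tri (u α β 0) .d (d α β 0)
          + tri (u α β 0 * d α β 0) .d 1)
  | .duu =>
      (tri 1 .d (u α β 0 * u α β 0) + tri (d α β 0) .u (u α β 0)
          + tri (d α β 0 * u α β 0) .u 1)
        - α • (tri 1 .u (d α β 0 * u α β 0) + tri (u α β 0) .d (u α β 0)
          + tri (u α β 0 * d α β 0) .u 1)
        - β • (tri 1 .u (u α β 0 * d α β 0) + tri (u α β 0) .u (d α β 0)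
          + tri (u α β 0 * u α β 0) .d 1)

/-- `δ₂ : A ⊗ R ⊗ A → A ⊗ V ⊗ A`. -/
noncomputable def delta2 (α β : K) :
    (DownUpRelWord → Env α β) →ₗ[Env α β] (DownUpGen → Env α β) :=
  Fintype.linearCombination (Env α β) (delta2Gen α β)

/-- The image of `1 ⊗ d²u² ⊗ 1` under `δ₃`. -/
noncomputable def delta3Gen (α β : K) : DownUpRelWord → Env α β :=
  tri (d α β 0) .duu 1 + β • tri 1 .duu (d α β 0)
    - tri 1 .ddu (u α β 0) - β • tri (u α β 0) .ddu 1

/-- `δ₃ : A ⊗ Ω ⊗ A → A ⊗ R ⊗ A`; as `Ω` is spanned by `d²u²`, its source is `A ⊗ Aᵒᵖ`. -/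
noncomputable def delta3 (α β : K) : Env α β →ₗ[Env α β] (DownUpRelWord → Env α β) :=
  LinearMap.toSpanSingleton (Env α β) _ (delta3Gen α β)

theorem delta1_tri (α β : K) (x y : DownUpAlgebra α β 0) (v : DownUpGen) :
    delta1 α β (tri x v y)
      = (x * gen α β 0 v) ⊗ₜ[K] op y - x ⊗ₜ[K] op (gen α β 0 v * y) := by
  simp [delta1, tri, Fintype.linearCombination_apply_single, mul_sub]

theorem delta2_tri (α β : K) (x y : DownUpAlgebra α β 0) (v : DownUpRelWord) :
    delta2 α β (tri x v y) = (x ⊗ₜ[K] op y : Env α β) • delta2Gen α β v := by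
  simp [delta2, tri, Fintype.linearCombination_apply_single]

theorem smul_tri {α β : K} {ι : Type} [DecidableEq ι] (a b x y : DownUpAlgebra α β 0) (v : ι) :
    (a ⊗ₜ[K] op b : Env α β) • tri x v y = tri (a * x) v (y * b) := by
  ext i
  by_cases h : i = v
  · subst h
    simp [tri]
  · simp [tri, h]

theorem map_smul_base {α β : K} {ι : Type} {M : Type u} [AddCommGroup M] [Module K M]
    [Module (Env α β) M] [IsScalarTower K (Env α β) M]
    (f : (ι → Env α β) →ₗ[Env α β] M) (c : K) (z : ι → Env α β) : f (c • z) = c • f z := by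
  rw [← algebraMap_smul (Env α β) c z, map_smul, algebraMap_smul]

theorem smul_base_comm {α β : K} {ι : Type} (a : Env α β) (c : K) (z : ι → Env α β) :
    a • (c • z) = c • (a • z) := by
  ext i
  exact mul_smul_comm c a (z i)

theorem delta1_comp_delta2 (α β : K) : delta1 α β ∘ₗ delta2 α β = 0 := by
  have key : ∀ v, delta1 α β (delta2Gen α β v) = 0 := by
    intro v
    have h1 := ddu_eq α β (0 : K)
    have h2 := duu_eq α β (0 : K)
    cases v
    · simp only [delta2Gen, map_add, map_sub, map_smul_base, delta1_tri, one_mul, mul_one,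
        ← mul_assoc]
      simp only [h1, zero_smul, add_zero, MulOpposite.op_add, MulOpposite.op_smul,
        TensorProduct.tmul_add, TensorProduct.tmul_smul, TensorProduct.add_tmul,
        ← TensorProduct.smul_tmul', smul_add, smul_sub]
      abel
    · simp only [delta2Gen, map_add, map_sub, map_smul_base, delta1_tri, one_mul, mul_one,
        ← mul_assoc]
      simp only [h2, zero_smul, add_zero, MulOpposite.op_add, MulOpposite.op_smul,
        TensorProduct.tmul_add, TensorProduct.tmul_smul, TensorProduct.add_tmul,
        ← TensorProduct.smul_tmul', smul_add, smul_sub]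
      abel
  ext v : 2
  simp [delta2, key, Fintype.linearCombination_apply_single]

theorem delta2_comp_delta3 (α β : K) : delta2 α β ∘ₗ delta3 α β = 0 := by
  have key : delta2 α β (delta3Gen α β) = 0 := by
    have h1 := ddu_eq α β (0 : K)
    have h2 := duu_eq α β (0 : K)
    have tri_add_left : ∀ (x y z : DownUpAlgebra α β 0) (v : DownUpGen),
        tri (x + y) v z = tri x v z + tri y v z := by
      intro x y z v; simp [tri, TensorProduct.add_tmul, Pi.single_add]
    have tri_add_right : ∀ (x y z : DownUpAlgebra α β 0) (v : DownUpGen),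
        tri x v (y + z) = tri x v y + tri x v z := by
      intro x y z v; simp [tri, TensorProduct.tmul_add, Pi.single_add]
    have tri_smul_left : ∀ (c : K) (x y : DownUpAlgebra α β 0) (v : DownUpGen),
        tri (c • x) v y = c • tri x v y := by
      intro c x y v; simp [tri, ← TensorProduct.smul_tmul', Pi.single_smul]
    have tri_smul_right : ∀ (c : K) (x y : DownUpAlgebra α β 0) (v : DownUpGen),
        tri x v (c • y) = c • tri x v y := by
      intro c x y v; simp [tri, Pi.single_smul]
    simp only [delta3Gen, map_add, map_sub, map_smul_base, delta2_tri, delta2Gen, smul_add,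
      smul_sub, smul_base_comm, smul_tri, one_mul, mul_one, ← mul_assoc]
    simp only [h1, h2, zero_smul, add_zero, tri_add_left, tri_add_right, tri_smul_left,
      tri_smul_right, smul_add, smul_smul, mul_comm β α]
    abel
  ext
  simp [delta3, key]

/-- The terms `A ⊗ A`, `A ⊗ V ⊗ A`, `A ⊗ R ⊗ A`, `A ⊗ Ω ⊗ A`, `0`, `0`, … -/
noncomputable def koszulX (α β : K) : ℕ → ModuleCat.{u} (Env α β)
  | 0 => ModuleCat.of _ (Env α β)
  | 1 => ModuleCat.of _ (DownUpGen → Env α β)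
  | 2 => ModuleCat.of _ (DownUpRelWord → Env α β)
  | 3 => ModuleCat.of _ (Env α β)
  | _ + 4 => ModuleCat.of _ PUnit

/-- The differentials `δ₁`, `δ₂`, `δ₃`, `0`, … -/
noncomputable def koszulD (α β : K) : (n : ℕ) → (koszulX α β (n + 1) ⟶ koszulX α β n)
  | 0 => ModuleCat.ofHom (delta1 α β)
  | 1 => ModuleCat.ofHom (delta2 α β)
  | 2 => ModuleCat.ofHom (delta3 α β)
  | _ + 3 => 0

theorem koszulD_comp (α β : K) (n : ℕ) : koszulD α β (n + 1) ≫ koszulD α β n = 0 := by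
  match n with
  | 0 => exact ModuleCat.hom_ext (delta1_comp_delta2 α β)
  | 1 => exact ModuleCat.hom_ext (delta2_comp_delta3 α β)
  | _ + 2 => exact Limits.zero_comp

/-- The complex of bimodules
`0 → A ⊗ Ω ⊗ A → A ⊗ R ⊗ A → A ⊗ V ⊗ A → A ⊗ A → 0` for `A = A(α, β, 0)`. -/
noncomputable def koszulComplex (α β : K) : ChainComplex (ModuleCat.{u} (Env α β)) ℕ :=
  ChainComplex.of (koszulX α β) (koszulD α β) (koszulD_comp α β)

theorem koszulComplex_d (α β : K) (n : ℕ) :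
    (koszulComplex α β).d (n + 1) n = koszulD α β n :=
  ChainComplex.of_d (koszulX α β) (koszulD α β) n

theorem koszulComplex_projective (α β : K) (n : ℕ) : Projective ((koszulComplex α β).X n) := by
  change Projective (koszulX α β n)
  match n with
  | 0 => exact (IsProjective.iff_projective (Env α β)).1 inferInstance
  | 1 => exact (IsProjective.iff_projective (DownUpGen → Env α β)).1 inferInstance
  | 2 => exact (IsProjective.iff_projective (DownUpRelWord → Env α β)).1 inferInstance
  | 3 => exact (IsProjective.iff_projective (Env α β)).1 inferInstance
  | _ + 4 => exact (IsProjective.iff_projective PUnit).1 inferInstance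

theorem koszulD_comp_mul (α β : K) :
    (koszulComplex α β).d 1 0 ≫ bimoduleHomOfElem K (1 : DownUpAlgebra α β 0) = 0 := by
  let _ : Module (Env α β) (DownUpAlgebra α β 0) := instModuleTensorProductMop K _
  rw [koszulComplex_d]
  refine ModuleCat.hom_ext (?_ : LinearMap.toSpanSingleton (Env α β) (DownUpAlgebra α β 0) 1 ∘ₗ
    delta1 α β = 0)
  ext v : 2
  simp [delta1, Fintype.linearCombination_apply_single, sub_smul, TensorProduct.Algebra.smul_def]

/-- The augmentation of the complex, given by the multiplication map `A ⊗ A → A`. -/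
noncomputable def koszulAug (α β : K) :
    koszulComplex α β ⟶ (ChainComplex.single₀ (ModuleCat.{u} (Env α β))).obj
      (regularBimodule K (DownUpAlgebra α β 0)) :=
  ((koszulComplex α β).toSingle₀Equiv _).symm
    ⟨bimoduleHomOfElem K (1 : DownUpAlgebra α β 0), koszulD_comp_mul α β⟩

/-- The Koszul complex as a projective bimodule resolution, given that the augmentation is a
quasi-isomorphism, that is, that the augmented complex is exact. -/
noncomputable def koszulResolution (α β : K) (h : QuasiIso (koszulAug α β)) :
    ProjectiveResolution (regularBimodule K (DownUpAlgebra α β 0)) where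
  complex := koszulComplex α β
  projective := koszulComplex_projective α β
  π := koszulAug α β
  quasiIso := h

/-- The class in `HH³(A)` of the cochain `D²U² | a`, i.e. of the bimodule map
`A ⊗ Ω ⊗ A → A` with `1 ⊗ d²u² ⊗ 1 ↦ a`, all of these being cocycles. -/
noncomputable def cohClass3 (α β : K) (h : QuasiIso (koszulAug α β)) (a : DownUpAlgebra α β 0) :
    HochschildCohomology K (DownUpAlgebra α β 0) 3 :=
  (koszulResolution α β h).extMk (n := 3) (bimoduleHomOfElem K a) 4 rfl
    (by
      change (koszulComplex α β).d (3 + 1) 3 ≫ _ = 0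
      rw [koszulComplex_d]
      exact Limits.zero_comp)

/-- The subspace `{da + βad + a'u + βua' : a, a' ∈ A}` of `A = A(α, β, 0)`. -/
def boundary3 (α β : K) : Submodule K (DownUpAlgebra α β 0) where
  carrier := {x | ∃ a a' : DownUpAlgebra α β 0,
    x = d α β 0 * a + β • (a * d α β 0) + a' * u α β 0 + β • (u α β 0 * a')}
  zero_mem' := ⟨0, 0, by simp⟩
  add_mem' := by
    rintro _ _ ⟨a, a', rfl⟩ ⟨b, b', rfl⟩
    exact ⟨a + b, a' + b', by simp only [mul_add, add_mul, smul_add]; abel⟩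
  smul_mem' := by
    rintro c _ ⟨a, a', rfl⟩
    exact ⟨c • a, c • a', by
      simp only [smul_add, mul_smul_comm, smul_mul_assoc, smul_comm c β]⟩

/-- The family (F1) of graded generic down-up algebras `A(α, β, 0)`: `r₁, r₂` are the roots (with
multiplicity) of `t² - αt - β`, and `r₁ⁱ r₂ʲ ≠ 1` for all integers `(i, j) ≠ (0, 0)`, the roots
being nonzero so that the negative powers make sense. -/
def IsGradedGeneric (α β r₁ r₂ : K) : Prop :=
  (Polynomial.X ^ 2 - Polynomial.C α * Polynomial.X - Polynomial.C β : Polynomial K)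
      = (Polynomial.X - Polynomial.C r₁) * (Polynomial.X - Polynomial.C r₂)
    ∧ r₁ ≠ 0 ∧ r₂ ≠ 0 ∧ ∀ i j : ℤ, (i, j) ≠ (0, 0) → r₁ ^ i * r₂ ^ j ≠ 1

end DownUpAlgebra

/-!
Write `A = A(α, β, 0)` and `w = β ud + r₁ du`. The defining relations are equivalent to
`du = r₂ ud + r₁⁻¹ w`, `wu = r₁ uw`, `dw = r₁ wd` (`d_mul_u`, `w_mul_u`, `d_mul_w`,
`relations_of_commutation`), so that `A` is an iterated Ore extension with basis `uⁱ wʲ dᵏ`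
(`monomialBasis`); linear independence is seen by letting `A` act on the space spanned by the symbols
`uⁱ wʲ dᵏ`.

*The resolution.* Exactness at `A ⊗ A` and at `A ⊗ V ⊗ A` holds for every algebra given by
generators and relations. For the second, `v ↦ 1 ⊗ v ⊗ 1` extends to a derivation `D` from `A` to
`coker δ₂`, and `a ⊗ c ↦ D(a) c` is a retraction of `coker δ₂ → A ⊗ A` (`derivationMul_delta1`).
For the left half, `A ⊗ Aᵒᵖ` is regarded as a direct sum, over the `uⁱ wʲ`, of polynomials in
`d ⊗ 1` with coefficients in `Aᵒᵖ`. The `du²`-component of `δ₃` is right multiplication by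
`d ⊗ 1 - r₁r₂ (1 ⊗ d)`, which is monic in `d ⊗ 1`. This gives injectivity of `δ₃`
(`delta3_injective`) and division with remainder (`exists_eq_mul_twist_add`): modulo the image of
`δ₃`, the `du²`-component of a cycle of `δ₂` is a sum of terms `uⁱ wʲ ⊗ y i j`. The `u`-component of
the cycle condition, evaluated at `d ⊗ 1 = r₂ (1 ⊗ d)`, is the recursion
`r₁⁻¹ y i j = y i (j + 1) w` in `Aᵒᵖ` (`envEval_envIncl_mul`). It forces the remainder to vanish, and
then the `d²u`-component vanishes as well (`exact_delta3_delta2`).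

*The cohomology.* As the resolution stops in degree `3`, `HH³(A)` is the cokernel of the map induced
by `δ₃`, that is `A / {da + βad + a'u + βua'}` (`cohClass3_eq_zero_iff`). On monomials the
relations read `(r₂ⁱ r₁ʲ - r₁r₂) uⁱ wʲ dᵏ⁺¹ = -cᵢ uⁱ⁻¹ wʲ⁺¹ dᵏ`, and symmetrically in `u` and `d`.
By genericity the coefficient on the left vanishes only for `i = j = 1`. Hence `uⁱ wʲ dᵏ` is zero in
the quotient if `i ≠ k`, and `uⁱ wʲ dⁱ` is a multiple of `wⁱ⁺ʲ`, except that in the case `i + j = 2`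
the exceptional relation kills `w²` and leaves `uwd` free.
-/

/-! ### Generators and relations -/

namespace DownUpAlgebra

variable {K : Type u} [Field K]

section Generators

variable {α β γ : K}

/-- The quotient map from the free algebra. -/
noncomputable def mk (α β γ : K) : FreeAlgebra K DownUpGen →ₐ[K] DownUpAlgebra α β γ :=
  RingQuot.mkAlgHom K (DownUpRel α β γ)

theorem mk_surjective : Function.Surjective (mk α β γ) :=
  RingQuot.mkAlgHom_surjective K (DownUpRel α β γ)

/-- The algebra map out of a down-up algebra given by a pair of elements `U`, `D` satisfying the
defining relations. -/
noncomputable def lift {B : Type*} [Ring B] [Algebra K B] (U D : B)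
    (h₁ : D * D * U = α • (D * U * D) + β • (U * D * D) + γ • D)
    (h₂ : D * U * U = α • (U * D * U) + β • (U * U * D) + γ • U) :
    DownUpAlgebra α β γ →ₐ[K] B :=
  RingQuot.liftAlgHom K ⟨FreeAlgebra.lift K fun v => match v with
    | .u => U
    | .d => D, by
      rintro _ _ (_ | _)
      · simpa using h₁
      · simpa using h₂⟩

section

variable {B : Type*} [Ring B] [Algebra K B] (U D : B)
    (h₁ : D * D * U = α • (D * U * D) + β • (U * D * D) + γ • D)
    (h₂ : D * U * U = α • (U * D * U) + β • (U * U * D) + γ • U)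

@[simp]
theorem lift_u : lift U D h₁ h₂ (u α β γ) = U := by
  simp only [lift, gen]
  exact (RingQuot.liftAlgHom_mkAlgHom_apply ..).trans (by simp)

@[simp]
theorem lift_d : lift U D h₁ h₂ (d α β γ) = D := by
  simp only [lift, gen]
  exact (RingQuot.liftAlgHom_mkAlgHom_apply ..).trans (by simp)

end

/-- A subspace containing `1` and stable under left multiplication by `u` and `d` is everything. -/
theorem mem_of_mul_mem (S : Submodule K (DownUpAlgebra α β γ)) (h1 : 1 ∈ S)
    (hu : ∀ x ∈ S, u α β γ * x ∈ S) (hd : ∀ x ∈ S, d α β γ * x ∈ S)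
    (a : DownUpAlgebra α β γ) : a ∈ S := by
  suffices h : ∀ s ∈ S, a * s ∈ S by simpa using h 1 h1
  obtain ⟨a, rfl⟩ := mk_surjective a
  induction a using FreeAlgebra.induction with
  | grade0 r =>
    intro s hs
    rw [AlgHom.commutes, ← Algebra.smul_def]
    exact S.smul_mem r hs
  | grade1 v =>
    cases v
    · exact hu
    · exact hd
  | mul a b ha hb =>
    intro s hs
    rw [map_mul, mul_assoc]
    exact ha _ (hb _ hs)
  | add a b ha hb =>
    intro s hs
    rw [map_add, add_mul]
    exact S.add_mem (ha _ hs) (hb _ hs)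

end Generators

section Roots

variable {α β r₁ r₂ : K}

theorem IsGradedGeneric.mul_eq (h : IsGradedGeneric α β r₁ r₂) : β = -(r₁ * r₂) := by
  have := congrArg (Polynomial.eval 0) h.1
  simp at this
  linear_combination -this

theorem IsGradedGeneric.add_eq (h : IsGradedGeneric α β r₁ r₂) : α = r₁ + r₂ := by
  have := congrArg (Polynomial.eval 1) h.1
  simp at this
  linear_combination -this - h.mul_eq

theorem d_mul_u (hβ : β = -(r₁ * r₂)) (hr : r₁ ≠ 0) :
    d α β 0 * u α β 0 = r₂ • (u α β 0 * d α β 0) + r₁⁻¹ • w α β r₁ := by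
  rw [w, smul_add, smul_smul, smul_smul, inv_mul_cancel₀ hr, one_smul, hβ, ← add_assoc, ← add_smul,
    show r₂ + r₁⁻¹ * -(r₁ * r₂) = 0 by field_simp; ring]
  simp

theorem w_mul_u (hα : α = r₁ + r₂) (hβ : β = -(r₁ * r₂)) :
    w α β r₁ * u α β 0 = r₁ • (u α β 0 * w α β r₁) := by
  have h := duu_eq α β (0 : K)
  simp only [zero_smul, add_zero] at h
  simp only [w, add_mul, smul_mul_assoc, h, mul_add, mul_smul_comm, ← mul_assoc]
  subst hα hβ
  module

theorem d_mul_w (hα : α = r₁ + r₂) (hβ : β = -(r₁ * r₂)) :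
    d α β 0 * w α β r₁ = r₁ • (w α β r₁ * d α β 0) := by
  have h := ddu_eq α β (0 : K)
  simp only [zero_smul, add_zero] at h
  simp only [w, add_mul, smul_mul_assoc, mul_add, mul_smul_comm, ← mul_assoc, h]
  subst hα hβ
  module

/-- Conversely, elements satisfying the three `q`-commutation relations satisfy the defining
relations of the down-up algebra. -/
theorem relations_of_commutation (hα : α = r₁ + r₂) (hβ : β = -(r₁ * r₂)) (hr : r₁ ≠ 0)
    {B : Type*} [Ring B] [Algebra K B] {U W D : B} (hDU : D * U = r₂ • (U * D) + r₁⁻¹ • W)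
    (hWU : W * U = r₁ • (U * W)) (hDW : D * W = r₁ • (W * D)) :
    D * D * U = α • (D * U * D) + β • (U * D * D) + (0 : K) • D ∧
      D * U * U = α • (U * D * U) + β • (U * U * D) + (0 : K) • U := by
  have hW : W = r₁ • (D * U) - (r₁ * r₂) • (U * D) := by
    rw [hDU, smul_add, smul_smul, smul_smul, mul_inv_cancel₀ hr]
    module
  constructor
  · have h : D * D * U = r₂ • (D * U * D) + W * D := by
      rw [mul_assoc, mul_assoc D U D, hDU, mul_add, mul_smul_comm, mul_smul_comm, hDW, smul_smul,
        inv_mul_cancel₀ hr, one_smul]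
    rw [h, hW]
    simp only [sub_mul, smul_mul_assoc]
    subst hα hβ
    module
  · have h : D * U * U = r₂ • (U * D * U) + U * W := by
      rw [hDU, add_mul, smul_mul_assoc, smul_mul_assoc, hWU, smul_smul, inv_mul_cancel₀ hr,
        one_smul]
    rw [h, hW]
    simp only [mul_sub, mul_smul_comm, ← mul_assoc]
    subst hα hβ
    module

end Roots

/-! ### The Poincaré–Birkhoff–Witt basis -/

section PBW

/-- The coefficient `cₙ = r₁⁻¹ (r₂ⁿ⁻¹ + r₂ⁿ⁻² r₁ + ⋯ + r₁ⁿ⁻¹)` in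
`d uⁿ = r₂ⁿ uⁿ d + cₙ uⁿ⁻¹ w` and `dⁿ u = r₂ⁿ u dⁿ + cₙ w dⁿ⁻¹`. -/
def crossCoeff (r₁ r₂ : K) : ℕ → K
  | 0 => 0
  | n + 1 => r₁⁻¹ * r₂ ^ n + r₁ * crossCoeff r₁ r₂ n

theorem crossCoeff_succ (r₁ r₂ : K) (n : ℕ) :
    crossCoeff r₁ r₂ (n + 1) = r₂ * crossCoeff r₁ r₂ n + r₁⁻¹ * r₁ ^ n := by
  induction n with
  | zero => simp [crossCoeff]
  | succ n ih =>
    have h (n : ℕ) : crossCoeff r₁ r₂ (n + 1) = r₁⁻¹ * r₂ ^ n + r₁ * crossCoeff r₁ r₂ n := rfl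
    linear_combination h (n + 1) + r₁ * ih - r₂ * h n

variable {α β r₁ r₂ : K}

theorem w_pow_mul_u (hα : α = r₁ + r₂) (hβ : β = -(r₁ * r₂)) (n : ℕ) :
    w α β r₁ ^ n * u α β 0 = r₁ ^ n • (u α β 0 * w α β r₁ ^ n) := by
  induction n with
  | zero => simp
  | succ n ih =>
    rw [pow_succ', mul_assoc, ih, mul_smul_comm, ← mul_assoc, w_mul_u hα hβ, smul_mul_assoc,
      smul_smul, ← pow_succ, mul_assoc]

theorem d_mul_w_pow (hα : α = r₁ + r₂) (hβ : β = -(r₁ * r₂)) (n : ℕ) :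
    d α β 0 * w α β r₁ ^ n = r₁ ^ n • (w α β r₁ ^ n * d α β 0) := by
  induction n with
  | zero => simp
  | succ n ih =>
    rw [pow_succ, ← mul_assoc, ih, smul_mul_assoc, mul_assoc, d_mul_w hα hβ, mul_smul_comm,
      smul_smul, ← pow_succ, mul_assoc]

theorem d_mul_u_pow (hα : α = r₁ + r₂) (hβ : β = -(r₁ * r₂)) (hr : r₁ ≠ 0) (n : ℕ) :
    d α β 0 * u α β 0 ^ n = r₂ ^ n • (u α β 0 ^ n * d α β 0)
      + crossCoeff r₁ r₂ n • (u α β 0 ^ (n - 1) * w α β r₁) := by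
  induction n with
  | zero => simp [crossCoeff]
  | succ n ih =>
    have h : crossCoeff r₁ r₂ n • (u α β 0 ^ (n - 1) * w α β r₁ * u α β 0)
        = (r₁ * crossCoeff r₁ r₂ n) • (u α β 0 ^ n * w α β r₁) := by
      cases n with
      | zero => simp [crossCoeff]
      | succ n =>
        rw [mul_assoc, w_mul_u hα hβ, mul_smul_comm, smul_smul, ← mul_assoc, Nat.add_sub_cancel,
          ← pow_succ, mul_comm r₁]
    rw [pow_succ, ← mul_assoc, ih, add_mul, smul_mul_assoc, smul_mul_assoc, h, mul_assoc,
      d_mul_u hβ hr, mul_add, mul_smul_comm, mul_smul_comm, ← mul_assoc, Nat.add_sub_cancel,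
      crossCoeff]
    module

theorem d_pow_mul_u (hα : α = r₁ + r₂) (hβ : β = -(r₁ * r₂)) (hr : r₁ ≠ 0) (n : ℕ) :
    d α β 0 ^ n * u α β 0 = r₂ ^ n • (u α β 0 * d α β 0 ^ n)
      + crossCoeff r₁ r₂ n • (w α β r₁ * d α β 0 ^ (n - 1)) := by
  induction n with
  | zero => simp [crossCoeff]
  | succ n ih =>
    have h : crossCoeff r₁ r₂ n • (d α β 0 * (w α β r₁ * d α β 0 ^ (n - 1)))
        = (r₁ * crossCoeff r₁ r₂ n) • (w α β r₁ * d α β 0 ^ n) := by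
      cases n with
      | zero => simp [crossCoeff]
      | succ n =>
        rw [← mul_assoc, d_mul_w hα hβ, smul_mul_assoc, smul_smul, mul_assoc, Nat.add_sub_cancel,
          ← pow_succ', mul_comm r₁]
    rw [pow_succ', mul_assoc, ih, mul_add, mul_smul_comm, mul_smul_comm, h, ← mul_assoc,
      d_mul_u hβ hr, add_mul, smul_mul_assoc, smul_mul_assoc, mul_assoc, Nat.add_sub_cancel,
      crossCoeff]
    module

/-- The ordered monomial `uⁱ wʲ dᵏ`. -/
noncomputable def monomial (α β r₁ : K) (n : ℕ × ℕ × ℕ) : DownUpAlgebra α β 0 :=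
  u α β 0 ^ n.1 * w α β r₁ ^ n.2.1 * d α β 0 ^ n.2.2

theorem u_mul_monomial (i j k : ℕ) :
    u α β 0 * monomial α β r₁ (i, j, k) = monomial α β r₁ (i + 1, j, k) := by
  simp only [monomial, pow_succ', mul_assoc]

theorem monomial_mul_d (i j k : ℕ) :
    monomial α β r₁ (i, j, k) * d α β 0 = monomial α β r₁ (i, j, k + 1) := by
  simp only [monomial, pow_succ, mul_assoc]

theorem d_mul_monomial (hα : α = r₁ + r₂) (hβ : β = -(r₁ * r₂)) (hr : r₁ ≠ 0) (i j k : ℕ) :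
    d α β 0 * monomial α β r₁ (i, j, k) =
      (r₂ ^ i * r₁ ^ j) • monomial α β r₁ (i, j, k + 1)
        + crossCoeff r₁ r₂ i • monomial α β r₁ (i - 1, j + 1, k) := by
  simp only [monomial]
  rw [← mul_assoc, ← mul_assoc, d_mul_u_pow hα hβ hr, add_mul, add_mul]
  congr 1
  · rw [smul_mul_assoc, smul_mul_assoc, mul_assoc _ (d α β 0), d_mul_w_pow hα hβ, mul_smul_comm,
      smul_mul_assoc, smul_smul, pow_succ']
    simp only [mul_assoc]
  · rw [smul_mul_assoc, smul_mul_assoc, pow_succ']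
    simp only [mul_assoc]

theorem monomial_mul_u (hα : α = r₁ + r₂) (hβ : β = -(r₁ * r₂)) (hr : r₁ ≠ 0) (i j k : ℕ) :
    monomial α β r₁ (i, j, k) * u α β 0 =
      (r₂ ^ k * r₁ ^ j) • monomial α β r₁ (i + 1, j, k)
        + crossCoeff r₁ r₂ k • monomial α β r₁ (i, j + 1, k - 1) := by
  simp only [monomial]
  rw [mul_assoc, d_pow_mul_u hα hβ hr, mul_add]
  congr 1
  · rw [mul_smul_comm, ← mul_assoc, mul_assoc _ _ (u α β 0), w_pow_mul_u hα hβ, mul_smul_comm,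
      smul_mul_assoc, smul_smul, pow_succ]
    simp only [mul_assoc]
  · rw [mul_smul_comm, pow_succ]
    simp only [mul_assoc]

/-- Left multiplication by `u`, written in the monomials `uⁱ wʲ dᵏ`. -/
noncomputable def uOp (K : Type u) [Field K] : Module.End K (ℕ × ℕ × ℕ →₀ K) :=
  Finsupp.linearCombination K fun n => Finsupp.single (n.1 + 1, n.2.1, n.2.2) 1

/-- Left multiplication by `w`, written in the monomials `uⁱ wʲ dᵏ`. -/
noncomputable def wOp (r₁ : K) : Module.End K (ℕ × ℕ × ℕ →₀ K) :=
  Finsupp.linearCombination K fun n => r₁ ^ n.1 • Finsupp.single (n.1, n.2.1 + 1, n.2.2) 1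

/-- Left multiplication by `d`, written in the monomials `uⁱ wʲ dᵏ`. -/
noncomputable def dOp (r₁ r₂ : K) : Module.End K (ℕ × ℕ × ℕ →₀ K) :=
  Finsupp.linearCombination K fun n =>
    (r₂ ^ n.1 * r₁ ^ n.2.1) • Finsupp.single (n.1, n.2.1, n.2.2 + 1) 1
      + crossCoeff r₁ r₂ n.1 • Finsupp.single (n.1 - 1, n.2.1 + 1, n.2.2) 1

theorem dOp_mul_uOp : dOp r₁ r₂ * uOp K = r₂ • (uOp K * dOp r₁ r₂) + r₁⁻¹ • wOp r₁ := by
  refine Finsupp.lhom_ext' fun ⟨i, j, k⟩ => LinearMap.ext_ring ?_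
  simp only [uOp, dOp, wOp, LinearMap.coe_comp, Function.comp_apply, Finsupp.lsingle_apply,
    Module.End.mul_apply, LinearMap.add_apply, LinearMap.smul_apply, map_add, map_smul,
    Finsupp.linearCombination_single, one_smul, Nat.add_sub_cancel, crossCoeff_succ r₁ r₂ i]
  cases i with
  | zero => simp only [crossCoeff]; module
  | succ i => simp only [Nat.add_sub_cancel]; module

theorem wOp_mul_uOp : wOp r₁ * uOp K = r₁ • (uOp K * wOp r₁) := by
  refine Finsupp.lhom_ext' fun ⟨i, j, k⟩ => LinearMap.ext_ring ?_
  simp only [uOp, wOp, LinearMap.coe_comp, Function.comp_apply, Finsupp.lsingle_apply,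
    Module.End.mul_apply, LinearMap.smul_apply, map_smul, Finsupp.linearCombination_single,
    one_smul]
  module

theorem dOp_mul_wOp : dOp r₁ r₂ * wOp r₁ = r₁ • (wOp r₁ * dOp r₁ r₂) := by
  refine Finsupp.lhom_ext' fun ⟨i, j, k⟩ => LinearMap.ext_ring ?_
  simp only [wOp, dOp, LinearMap.coe_comp, Function.comp_apply, Finsupp.lsingle_apply,
    Module.End.mul_apply, LinearMap.smul_apply, map_add, map_smul,
    Finsupp.linearCombination_single, one_smul]
  cases i with
  | zero => simp only [crossCoeff]; module
  | succ i => simp only [Nat.add_sub_cancel]; module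

/-- The action of `A(α, β, 0)` on the space spanned by the symbols `uⁱ wʲ dᵏ`. -/
noncomputable def monomialRep (hα : α = r₁ + r₂) (hβ : β = -(r₁ * r₂)) (hr : r₁ ≠ 0) :
    DownUpAlgebra α β 0 →ₐ[K] Module.End K (ℕ × ℕ × ℕ →₀ K) :=
  have h := relations_of_commutation hα hβ hr (dOp_mul_uOp (r₁ := r₁) (r₂ := r₂)) wOp_mul_uOp
    dOp_mul_wOp
  lift (uOp K) (dOp r₁ r₂) h.1 h.2

theorem monomialRep_w (hα : α = r₁ + r₂) (hβ : β = -(r₁ * r₂)) (hr : r₁ ≠ 0) :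
    monomialRep hα hβ hr (w α β r₁) = wOp r₁ := by
  simp only [w, map_add, map_smul, map_mul, monomialRep, lift_u, lift_d, dOp_mul_uOp, hβ]
  rw [smul_add, smul_smul r₁ r₁⁻¹, mul_inv_cancel₀ hr]
  module

/-- The action on the symbol of `1` recovers the monomials, which are therefore independent. -/
theorem monomialRep_monomial (hα : α = r₁ + r₂) (hβ : β = -(r₁ * r₂)) (hr : r₁ ≠ 0)
    (n : ℕ × ℕ × ℕ) :
    monomialRep hα hβ hr (monomial α β r₁ n) (Finsupp.single (0, 0, 0) 1)
      = Finsupp.single n 1 := by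
  obtain ⟨i, j, k⟩ := n
  have hd : ∀ k, (dOp r₁ r₂ ^ k) (Finsupp.single (0, 0, 0) 1) = Finsupp.single (0, 0, k) 1 := by
    intro k
    induction k with
    | zero => simp
    | succ k ih => 
      rw [pow_succ', Module.End.mul_apply, ih, dOp, Finsupp.linearCombination_single]
      simp only [pow_zero, mul_one, one_smul, crossCoeff, zero_smul, add_zero]
  have hw : ∀ j, (wOp r₁ ^ j) (Finsupp.single (0, 0, k) 1) = Finsupp.single (0, j, k) 1 := by
    intro j
    induction j with
    | zero => simp
    | succ j ih => rw [pow_succ', Module.End.mul_apply, ih]; simp [wOp]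
  have hu : ∀ i, (uOp K ^ i) (Finsupp.single (0, j, k) 1) = Finsupp.single (i, j, k) 1 := by
    intro i
    induction i with
    | zero => simp
    | succ i ih => rw [pow_succ', Module.End.mul_apply, ih]; simp [uOp]
  rw [monomial, map_mul, map_mul, map_pow, map_pow, map_pow, monomialRep_w]
  simp only [monomialRep, lift_u, lift_d, Module.End.mul_apply, hd, hw, hu]

/-- The Poincaré–Birkhoff–Witt basis `uⁱ wʲ dᵏ` of `A(α, β, 0)`. -/
noncomputable def monomialBasis (hα : α = r₁ + r₂) (hβ : β = -(r₁ * r₂)) (hr : r₁ ≠ 0) :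
    Module.Basis (ℕ × ℕ × ℕ) K (DownUpAlgebra α β 0) :=
  Module.Basis.mk (v := monomial α β r₁)
    (by
      refine LinearIndependent.of_comp
        (LinearMap.applyₗ (Finsupp.single (0, 0, 0) 1) ∘ₗ (monomialRep hα hβ hr).toLinearMap) ?_
      convert Finsupp.linearIndependent_single_one K (ℕ × ℕ × ℕ) with n
      exact monomialRep_monomial hα hβ hr n)
    (by
      have hm : ∀ n, monomial α β r₁ n ∈ Submodule.span K (Set.range (monomial α β r₁)) :=
        fun n => Submodule.subset_span ⟨n, rfl⟩
      rintro a -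
      refine mem_of_mul_mem _ ?_ ?_ ?_ a
      · simpa [monomial] using hm (0, 0, 0)
      · intro x hx
        induction hx using Submodule.span_induction with
        | mem x hx =>
          obtain ⟨⟨i, j, k⟩, rfl⟩ := hx
          rw [u_mul_monomial]
          exact hm _
        | zero => simp
        | add x y _ _ hx hy => rw [mul_add]; exact Submodule.add_mem _ hx hy
        | smul c x _ hx => rw [mul_smul_comm]; exact Submodule.smul_mem _ c hx
      · intro x hx
        induction hx using Submodule.span_induction with
        | mem x hx =>
          obtain ⟨⟨i, j, k⟩, rfl⟩ := hx
          rw [d_mul_monomial hα hβ hr]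
          exact Submodule.add_mem _ (Submodule.smul_mem _ _ (hm _))
            (Submodule.smul_mem _ _ (hm _))
        | zero => simp
        | add x y _ _ hx hy => rw [mul_add]; exact Submodule.add_mem _ hx hy
        | smul c x _ hx => rw [mul_smul_comm]; exact Submodule.smul_mem _ c hx)

@[simp]
theorem monomialBasis_apply (hα : α = r₁ + r₂) (hβ : β = -(r₁ * r₂)) (hr : r₁ ≠ 0)
    (n : ℕ × ℕ × ℕ) : monomialBasis hα hβ hr n = monomial α β r₁ n := by
  simp [monomialBasis]

end PBW

/-! ### Exactness of the presentation part of the complex -/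

section Presentation

variable {α β : K}

/-- The kernel of the multiplication map is generated by the elements `v ⊗ 1 - 1 ⊗ v`: by
induction on `y`, the tensor `x ⊗ y` is congruent to `x y ⊗ 1` modulo the image of `δ₁`. -/
theorem tmul_sub_mem_range_delta1 (y x : DownUpAlgebra α β 0) :
    (x ⊗ₜ[K] op y - (x * y) ⊗ₜ[K] op 1 : Env α β) ∈ LinearMap.range (delta1 α β) := by
  have step : ∀ (v : DownUpGen) (y : DownUpAlgebra α β 0),
      (∀ x : DownUpAlgebra α β 0, (x ⊗ₜ[K] op y - (x * y) ⊗ₜ[K] op 1 : Env α β) ∈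
        LinearMap.range (delta1 α β)) →
      ∀ x : DownUpAlgebra α β 0,
        (x ⊗ₜ[K] op (gen α β 0 v * y) - (x * (gen α β 0 v * y)) ⊗ₜ[K] op 1 : Env α β) ∈
          LinearMap.range (delta1 α β) := by
    intro v y hy x
    have h := Submodule.sub_mem _ (hy (x * gen α β 0 v))
      (LinearMap.mem_range_self (delta1 α β) (tri x v y))
    rw [delta1_tri] at h
    convert h using 1
    rw [mul_assoc]
    abel
  let S : Submodule K (DownUpAlgebra α β 0) :=
    { carrier := {y | ∀ x : DownUpAlgebra α β 0, (x ⊗ₜ[K] op y - (x * y) ⊗ₜ[K] op 1 : Env α β) ∈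
        LinearMap.range (delta1 α β)}
      zero_mem' := fun x => by
        rw [MulOpposite.op_zero, mul_zero, TensorProduct.tmul_zero, TensorProduct.zero_tmul,
          sub_self]
        exact zero_mem _
      add_mem' := by
        intro y z hy hz x
        convert Submodule.add_mem _ (hy x) (hz x) using 1
        rw [MulOpposite.op_add, TensorProduct.tmul_add, mul_add, TensorProduct.add_tmul]
        abel
      smul_mem' := by
        intro c y hy x
        convert Submodule.smul_of_tower_mem _ c (hy x) using 1
        rw [MulOpposite.op_smul, TensorProduct.tmul_smul, mul_smul_comm,
          ← TensorProduct.smul_tmul', smul_sub] }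
  exact mem_of_mul_mem S (fun x => by rw [mul_one, sub_self]; exact zero_mem _)
    (fun y hy => step .u y hy) (fun y hy => step .d y hy) y x

/-- The cokernel of `δ₂`, which turns out to be the bimodule of noncommutative differentials. -/
def Differentials (α β : K) : Type u := (DownUpGen → Env α β) ⧸ LinearMap.range (delta2 α β)

namespace Differentials

noncomputable instance : AddCommGroup (Differentials α β) :=
  inferInstanceAs (AddCommGroup ((DownUpGen → Env α β) ⧸ LinearMap.range (delta2 α β)))

noncomputable instance : Module (Env α β) (Differentials α β) :=
  inferInstanceAs (Module (Env α β) ((DownUpGen → Env α β) ⧸ LinearMap.range (delta2 α β)))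

noncomputable instance : Module K (Differentials α β) :=
  Module.restrictScalars K (Env α β) _

instance : IsScalarTower K (Env α β) (Differentials α β) :=
  IsScalarTower.restrictScalars K (Env α β) _

/-- The quotient map `A ⊗ V ⊗ A → coker δ₂`. -/
noncomputable def mk (α β : K) : (DownUpGen → Env α β) →ₗ[Env α β] Differentials α β :=
  (LinearMap.range (delta2 α β)).mkQ

theorem mk_eq_zero (z : DownUpGen → Env α β) :
    mk α β z = 0 ↔ z ∈ LinearMap.range (delta2 α β) :=
  Submodule.Quotient.mk_eq_zero _

end Differentials

/-- The class of `1 ⊗ v ⊗ c` in the cokernel of `δ₂`, as a linear function of `c`. -/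
noncomputable def differential (α β : K) (v : DownUpGen) :
    DownUpAlgebra α β 0 →ₗ[K] Differentials α β :=
  (Differentials.mk α β).restrictScalars K ∘ₗ LinearMap.single K _ v ∘ₗ
    TensorProduct.mk K _ _ 1 ∘ₗ (MulOpposite.opLinearEquiv K).toLinearMap

theorem tmul_smul_differential (v : DownUpGen) (a c : DownUpAlgebra α β 0) :
    (a ⊗ₜ[K] op 1 : Env α β) • differential α β v c = Differentials.mk α β (tri a v c) := by
  change _ • Differentials.mk α β (tri 1 v c) = _
  rw [← map_smul, smul_tri, mul_one, mul_one]

theorem differential_apply (v : DownUpGen) (c : DownUpAlgebra α β 0) :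
    differential α β v c = Differentials.mk α β (tri 1 v c) := rfl

/-- The operator `(m, c) ↦ (v m + 1 ⊗ v ⊗ c, v c)`. The resulting representation of `A` is the
square-zero extension in which `v` acts through the universal derivation. -/
noncomputable def derivationOp (α β : K) (v : DownUpGen) :
    Module.End K (Differentials α β × DownUpAlgebra α β 0) :=
  LinearMap.prod
    (Algebra.lsmul K K (Differentials α β) (gen α β 0 v ⊗ₜ[K] op 1 : Env α β) ∘ₗ
      LinearMap.fst K _ _ + differential α β v ∘ₗ LinearMap.snd K _ _)
    (LinearMap.mulLeft K (gen α β 0 v) ∘ₗ LinearMap.snd K _ _)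

theorem derivationOp_apply (v : DownUpGen) (m : Differentials α β) (c : DownUpAlgebra α β 0) :
    derivationOp α β v (m, c) =
      ((gen α β 0 v ⊗ₜ[K] op 1 : Env α β) • m + differential α β v c, gen α β 0 v * c) := rfl

/-- The relations of `A`, differentiated, hold in the cokernel of `δ₂`. -/
theorem mk_smul_delta2Gen (v : DownUpRelWord) (c : DownUpAlgebra α β 0) :
    Differentials.mk α β (((1 : DownUpAlgebra α β 0) ⊗ₜ[K] op c : Env α β) • delta2Gen α β v)
      = 0 := by
  rw [Differentials.mk_eq_zero]
  exact ⟨tri 1 v c, delta2_tri α β 1 c v⟩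

theorem derivationOp_mul_mul_apply (v₁ v₂ v₃ : DownUpGen) (m : Differentials α β)
    (c : DownUpAlgebra α β 0) :
    (derivationOp α β v₁ * derivationOp α β v₂ * derivationOp α β v₃) (m, c) =
      (((gen α β 0 v₁ * gen α β 0 v₂ * gen α β 0 v₃) ⊗ₜ[K] op 1 : Env α β) • m +
        Differentials.mk α β (tri (gen α β 0 v₁ * gen α β 0 v₂) v₃ c +
          tri (gen α β 0 v₁) v₂ (gen α β 0 v₃ * c) + tri 1 v₁ (gen α β 0 v₂ * gen α β 0 v₃ * c)),
        gen α β 0 v₁ * gen α β 0 v₂ * gen α β 0 v₃ * c) := by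
  have h1 : (op 1 * op 1 : (DownUpAlgebra α β 0)ᵐᵒᵖ) = op 1 := one_mul _
  simp only [Module.End.mul_apply, derivationOp_apply, smul_add, smul_smul,
    Algebra.TensorProduct.tmul_mul_tmul, h1, ← mul_assoc, differential_apply, map_add,
    ← add_assoc, ← map_smul, smul_tri, mul_one]

theorem derivationOp_ddu :
    derivationOp α β .d * derivationOp α β .d * derivationOp α β .u =
      α • (derivationOp α β .d * derivationOp α β .u * derivationOp α β .d)
        + β • (derivationOp α β .u * derivationOp α β .d * derivationOp α β .d)
        + (0 : K) • derivationOp α β .d := by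
  refine LinearMap.ext fun ⟨m, c⟩ => ?_
  have h := ddu_eq α β (0 : K)
  have hq := mk_smul_delta2Gen (α := α) (β := β) .ddu c
  simp only [delta2Gen, smul_sub, smul_add, smul_base_comm, smul_tri, one_mul, mul_one] at hq
  simp only [LinearMap.add_apply, LinearMap.smul_apply, derivationOp_mul_mul_apply,
    zero_smul, add_zero, Prod.smul_mk, Prod.mk_add_mk] at h ⊢
  refine Prod.ext ?_ ?_
  · simp only [h, TensorProduct.add_tmul, ← TensorProduct.smul_tmul', add_smul, smul_assoc]
    rw [← sub_eq_zero, ← hq]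
    simp only [map_add, map_sub, map_smul_base]
    generalize ((gen α β 0 .d * gen α β 0 .u * gen α β 0 .d) ⊗ₜ[K] op 1 : Env α β) • m = X
    generalize ((gen α β 0 .u * gen α β 0 .d * gen α β 0 .d) ⊗ₜ[K] op 1 : Env α β) • m = Y
    module
  · simp only [h, add_mul, smul_mul_assoc]

theorem derivationOp_duu :
    derivationOp α β .d * derivationOp α β .u * derivationOp α β .u =
      α • (derivationOp α β .u * derivationOp α β .d * derivationOp α β .u)
        + β • (derivationOp α β .u * derivationOp α β .u * derivationOp α β .d)
        + (0 : K) • derivationOp α β .u := by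
  refine LinearMap.ext fun ⟨m, c⟩ => ?_
  have h := duu_eq α β (0 : K)
  have hq := mk_smul_delta2Gen (α := α) (β := β) .duu c
  simp only [delta2Gen, smul_sub, smul_add, smul_base_comm, smul_tri, one_mul, mul_one] at hq
  simp only [LinearMap.add_apply, LinearMap.smul_apply, derivationOp_mul_mul_apply,
    zero_smul, add_zero, Prod.smul_mk, Prod.mk_add_mk] at h ⊢
  refine Prod.ext ?_ ?_
  · simp only [h, TensorProduct.add_tmul, ← TensorProduct.smul_tmul', add_smul, smul_assoc]
    rw [← sub_eq_zero, ← hq]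
    simp only [map_add, map_sub, map_smul_base]
    generalize ((gen α β 0 .u * gen α β 0 .d * gen α β 0 .u) ⊗ₜ[K] op 1 : Env α β) • m = X
    generalize ((gen α β 0 .u * gen α β 0 .u * gen α β 0 .d) ⊗ₜ[K] op 1 : Env α β) • m = Y
    module
  · simp only [h, add_mul, smul_mul_assoc]

/-- The representation of `A` on `coker δ₂ × A` by the operators `derivationOp`. -/
noncomputable def derivationRep (α β : K) :
    DownUpAlgebra α β 0 →ₐ[K] Module.End K (Differentials α β × DownUpAlgebra α β 0) :=
  lift (derivationOp α β .u) (derivationOp α β .d) derivationOp_ddu derivationOp_duu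

theorem derivationRep_gen (v : DownUpGen) :
    derivationRep α β (gen α β 0 v) = derivationOp α β v := by
  cases v
  · exact lift_u ..
  · exact lift_d ..

/-- The map `A ⊗ A → coker δ₂`, `a ⊗ c ↦ D(a) c`, for `D` the universal derivation. It is a
retraction of the map `coker δ₂ → A ⊗ A` induced by `δ₁`. -/
noncomputable def derivationMul (α β : K) : Env α β →ₗ[K] Differentials α β :=
  TensorProduct.lift <| LinearMap.mk₂ K
    (fun a c => (derivationRep α β a (0, MulOpposite.unop c)).1)
    (fun a b c => by simp) (fun r a c => by simp)
    (fun a b c => by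
      rw [MulOpposite.unop_add, ← Prod.fst_add, ← map_add, Prod.mk_add_mk, add_zero])
    (fun r a c => by
      rw [MulOpposite.unop_smul, ← Prod.smul_fst, ← map_smul, Prod.smul_mk, smul_zero])

theorem derivationRep_apply (a : DownUpAlgebra α β 0) (m : Differentials α β)
    (c : DownUpAlgebra α β 0) :
    derivationRep α β a (m, c) =
      ((a ⊗ₜ[K] op 1 : Env α β) • m + derivationMul α β (a ⊗ₜ[K] op c), a * c) := by
  let S : Submodule K (DownUpAlgebra α β 0) :=
    { carrier := {a | ∀ (m : Differentials α β) (c : DownUpAlgebra α β 0),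
        derivationRep α β a (m, c) =
          ((a ⊗ₜ[K] op 1 : Env α β) • m + derivationMul α β (a ⊗ₜ[K] op c), a * c)}
      zero_mem' := fun m c => by
        rw [map_zero, TensorProduct.zero_tmul, TensorProduct.zero_tmul, map_zero, zero_mul,
          add_zero]
        exact Prod.ext (zero_smul (Env α β) m).symm rfl
      add_mem' := by
        intro a b ha hb m c
        rw [map_add, LinearMap.add_apply, ha, hb, TensorProduct.add_tmul, TensorProduct.add_tmul,
          map_add, add_smul, add_mul, Prod.mk_add_mk]
        congr 1
        abel
      smul_mem' := by
        intro r a ha m c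
        rw [map_smul, LinearMap.smul_apply, ha, ← TensorProduct.smul_tmul',
          ← TensorProduct.smul_tmul', map_smul, smul_assoc, smul_mul_assoc, Prod.smul_mk,
          smul_add] }
  have step (v : DownUpGen) : ∀ a ∈ S, gen α β 0 v * a ∈ S := by
    intro a ha m c
    have h : derivationMul α β ((gen α β 0 v * a) ⊗ₜ[K] op c) =
        (derivationRep α β (gen α β 0 v * a) (0, c)).1 := rfl
    have h1 : (op 1 * op 1 : (DownUpAlgebra α β 0)ᵐᵒᵖ) = op 1 := one_mul _
    rw [h, map_mul, Module.End.mul_apply, Module.End.mul_apply, ha, ha, derivationRep_gen,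
      derivationOp_apply, derivationOp_apply, smul_zero, zero_add, smul_add, smul_smul,
      Algebra.TensorProduct.tmul_mul_tmul, h1, mul_assoc, add_assoc]
  refine mem_of_mul_mem S (fun m c => ?_) (step .u) (step .d) a m c
  have h : derivationMul α β (1 ⊗ₜ[K] op c) = (derivationRep α β 1 (0, c)).1 := rfl
  rw [h, map_one, Module.End.one_apply, Module.End.one_apply, add_zero, one_mul]
  exact Prod.ext (one_smul _ m).symm rfl

theorem derivationMul_delta1_tri (x y : DownUpAlgebra α β 0) (v : DownUpGen) :
    derivationMul α β (delta1 α β (tri x v y)) = Differentials.mk α β (tri x v y) := by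
  have h : derivationMul α β ((x * gen α β 0 v) ⊗ₜ[K] op y) =
      (derivationRep α β (x * gen α β 0 v) (0, y)).1 := rfl
  rw [delta1_tri, map_sub, h, map_mul, Module.End.mul_apply, derivationRep_gen,
    derivationOp_apply, smul_zero, zero_add, derivationRep_apply, add_sub_cancel_right,
    tmul_smul_differential]

/-- The elements `x ⊗ v ⊗ y` span `A ⊗ W ⊗ A`. -/
theorem tri_induction {ι : Type} [Fintype ι] [DecidableEq ι] {p : (ι → Env α β) → Prop}
    (h0 : p 0) (hadd : ∀ z z', p z → p z' → p (z + z')) (htri : ∀ x v y, p (tri x v y))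
    (z : ι → Env α β) : p z := by
  rw [← Finset.univ_sum_single z]
  refine Finset.sum_induction _ p hadd h0 fun v _ => ?_
  induction z v using TensorProduct.induction_on with
  | zero => rwa [Pi.single_zero]
  | tmul x y => exact htri x v y.unop
  | add a b ha hb => rw [Pi.single_add]; exact hadd _ _ ha hb

theorem derivationMul_delta1 (z : DownUpGen → Env α β) :
    derivationMul α β (delta1 α β z) = Differentials.mk α β z := by
  induction z using tri_induction with
  | h0 => simp
  | hadd z z' hz hz' => rw [map_add, map_add, hz, hz', map_add]
  | htri x v y => exact derivationMul_delta1_tri x y v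

theorem exact_delta2_delta1 : Function.Exact (delta2 α β) (delta1 α β) := by
  intro z
  constructor
  · intro hz
    have h := derivationMul_delta1 z
    rw [hz, map_zero, eq_comm, Differentials.mk_eq_zero] at h
    exact h
  · rintro ⟨z, rfl⟩
    exact LinearMap.congr_fun (delta1_comp_delta2 α β) z

/-- An element of `A ⊗ A` killed by the multiplication map lies in the image of `δ₁`. -/
theorem mem_range_delta1_of_mul_eq_zero (z : Env α β)
    (hz : (bimoduleHomOfElem K (1 : DownUpAlgebra α β 0)).hom z = 0) :
    z ∈ LinearMap.range (delta1 α β) := by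
  let _ : Module (Env α β) (DownUpAlgebra α β 0) := instModuleTensorProductMop K _
  let π : Env α β →ₗ[Env α β] DownUpAlgebra α β 0 := LinearMap.toSpanSingleton (Env α β) _ 1
  replace hz : π z = 0 := hz
  suffices h : z - π z ⊗ₜ[K] op 1 ∈ LinearMap.range (delta1 α β) by
    rwa [hz, TensorProduct.zero_tmul, sub_zero] at h
  clear hz
  induction z using TensorProduct.induction_on with
  | zero =>
    rw [map_zero, TensorProduct.zero_tmul, sub_zero]
    exact zero_mem _
  | tmul x y =>
    rw [LinearMap.toSpanSingleton_apply, TensorProduct.Algebra.smul_def]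
    simpa using tmul_sub_mem_range_delta1 y.unop x
  | add a b ha hb =>
    convert Submodule.add_mem _ ha hb using 1
    rw [map_add, TensorProduct.add_tmul]
    abel

end Presentation
end DownUpAlgebra

/-! ### Exactness of the left half of the complex -/

/-- A sequence that vanishes eventually, and at `k` whenever it does at `k + 1`, is zero. -/
theorem eq_zero_of_eventually_zero_of_succ {M : Type*} [Zero M] {f : ℕ → M}
    (hf : ∃ N, ∀ k, N ≤ k → f k = 0) (h : ∀ k, f (k + 1) = 0 → f k = 0) (k : ℕ) : f k = 0 := by
  obtain ⟨N, hN⟩ := hf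
  have key : ∀ m k, N ≤ k + m → f k = 0 := by
    intro m
    induction m with
    | zero => exact hN
    | succ m ih => exact fun k hk => h k (ih (k + 1) (by omega))
  exact key N k (by omega)

namespace DownUpAlgebra

variable {K : Type u} [Field K]

section LeftHalf

variable {α β r₁ r₂ : K}

/-- The element `d ⊗ 1 - r (1 ⊗ d)` of `A ⊗ Aᵒᵖ`. -/
noncomputable def twist (α β r : K) : Env α β :=
  d α β 0 ⊗ₜ[K] op 1 - r • (1 ⊗ₜ[K] op (d α β 0))

theorem tmul_mul_twist (x : DownUpAlgebra α β 0) (y : (DownUpAlgebra α β 0)ᵐᵒᵖ) (r : K) :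
    (x ⊗ₜ[K] y : Env α β) * twist α β r =
      (x * d α β 0) ⊗ₜ[K] y - r • (x ⊗ₜ[K] (y * op (d α β 0))) := by
  rw [twist, mul_sub, mul_smul_comm, Algebra.TensorProduct.tmul_mul_tmul,
    Algebra.TensorProduct.tmul_mul_tmul, mul_one, MulOpposite.op_one, mul_one]

/-- The coordinates of an element of `A ⊗ Aᵒᵖ`, viewed as a free right `Aᵒᵖ`-module on the basis
`uⁱ wʲ dᵏ` of the first factor. -/
noncomputable def envCoords (hα : α = r₁ + r₂) (hβ : β = -(r₁ * r₂)) (hr : r₁ ≠ 0) :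
    Env α β ≃ₗ[K] (ℕ × ℕ × ℕ →₀ (DownUpAlgebra α β 0)ᵐᵒᵖ) :=
  TensorProduct.congr (monomialBasis hα hβ hr).repr (LinearEquiv.refl K _) ≪≫ₗ
    TensorProduct.finsuppScalarLeft K _ _

theorem envCoords_monomial_tmul (hα : α = r₁ + r₂) (hβ : β = -(r₁ * r₂)) (hr : r₁ ≠ 0)
    (n : ℕ × ℕ × ℕ) (y : (DownUpAlgebra α β 0)ᵐᵒᵖ) :
    envCoords hα hβ hr (monomial α β r₁ n ⊗ₜ[K] y) = Finsupp.single n y := by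
  rw [← monomialBasis_apply hα hβ hr n, envCoords, LinearEquiv.trans_apply,
    TensorProduct.congr_tmul, Module.Basis.repr_self, TensorProduct.finsuppScalarLeft_apply_tmul,
    Finsupp.sum_single_index (by simp), one_smul, LinearEquiv.refl_apply]

theorem env_induction (hα : α = r₁ + r₂) (hβ : β = -(r₁ * r₂)) (hr : r₁ ≠ 0) {p : Env α β → Prop}
    (h0 : p 0) (hadd : ∀ z z', p z → p z' → p (z + z'))
    (hmon : ∀ i j k y, p (monomial α β r₁ (i, j, k) ⊗ₜ[K] y)) (z : Env α β) : p z := by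
  obtain ⟨f, rfl⟩ := (envCoords hα hβ hr).symm.surjective z
  induction f using Finsupp.induction_linear with
  | zero => rwa [map_zero]
  | add f g hf hg => rw [map_add]; exact hadd _ _ hf hg
  | single n y =>
    rw [← envCoords_monomial_tmul hα hβ hr, LinearEquiv.symm_apply_apply]
    exact hmon n.1 n.2.1 n.2.2 y

theorem envCoords_mul_twist (hα : α = r₁ + r₂) (hβ : β = -(r₁ * r₂)) (hr : r₁ ≠ 0) (r : K)
    (z : Env α β) (i j k : ℕ) :
    envCoords hα hβ hr (z * twist α β r) (i, j, k + 1) =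
      envCoords hα hβ hr z (i, j, k)
        - r • (envCoords hα hβ hr z (i, j, k + 1) * op (d α β 0)) := by
  induction z using env_induction hα hβ hr with
  | h0 => simp
  | hadd z z' hz hz' =>
    rw [add_mul, map_add, map_add, Finsupp.add_apply, Finsupp.add_apply, Finsupp.add_apply, hz,
      hz', add_mul, smul_add]
    abel
  | hmon i' j' k' y =>
    rw [tmul_mul_twist, monomial_mul_d, map_sub, map_smul, envCoords_monomial_tmul,
      envCoords_monomial_tmul, envCoords_monomial_tmul, Finsupp.sub_apply, Finsupp.smul_apply]
    congr 1
    · simp only [Finsupp.single_apply, Prod.mk.injEq, Nat.add_right_cancel_iff]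
    · simp only [Finsupp.single_apply, ite_mul, zero_mul]

/-- Right multiplication by `d ⊗ 1 - r (1 ⊗ d)` is injective, as it is monic in `d ⊗ 1`. -/
theorem eq_zero_of_mul_twist_eq_zero (hα : α = r₁ + r₂) (hβ : β = -(r₁ * r₂)) (hr : r₁ ≠ 0)
    {r : K} {z : Env α β} (hz : z * twist α β r = 0) : z = 0 := by
  refine (envCoords hα hβ hr).map_eq_zero_iff.1 (Finsupp.ext fun ⟨i, j, k⟩ => ?_)
  rw [Finsupp.zero_apply]
  refine eq_zero_of_eventually_zero_of_succ
    (f := fun k => envCoords hα hβ hr z (i, j, k))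
    ⟨(envCoords hα hβ hr z).support.sup (fun n => n.2.2) + 1, fun k hk => ?_⟩ (fun k hk => ?_) k
  · by_contra h
    have := Finset.le_sup (f := fun n : ℕ × ℕ × ℕ => n.2.2) (Finsupp.mem_support_iff.2 h)
    simp only at this
    omega
  · have h := envCoords_mul_twist hα hβ hr r z i j k
    rw [hz, map_zero, Finsupp.zero_apply, hk, zero_mul, smul_zero, sub_zero] at h
    exact h.symm

/-- The map `A ⊗ Aᵒᵖ → ⨁ Aᵒᵖ`, indexed by the `uⁱ wʲ`, which substitutes `r (1 ⊗ d)` for the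
powers of `d ⊗ 1` in the coordinates `envCoords`. -/
noncomputable def envEval (hα : α = r₁ + r₂) (hβ : β = -(r₁ * r₂)) (hr : r₁ ≠ 0) (r : K) :
    Env α β →ₗ[K] (ℕ × ℕ →₀ (DownUpAlgebra α β 0)ᵐᵒᵖ) :=
  Finsupp.lsum K (fun n : ℕ × ℕ × ℕ => Finsupp.lsingle (n.1, n.2.1) ∘ₗ
    (r ^ n.2.2 • LinearMap.mulRight K (op (d α β 0) ^ n.2.2))) ∘ₗ
      (envCoords hα hβ hr).toLinearMap

theorem envEval_monomial_tmul (hα : α = r₁ + r₂) (hβ : β = -(r₁ * r₂)) (hr : r₁ ≠ 0) (r : K)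
    (i j k : ℕ) (y : (DownUpAlgebra α β 0)ᵐᵒᵖ) :
    envEval hα hβ hr r (monomial α β r₁ (i, j, k) ⊗ₜ[K] y) =
      Finsupp.single (i, j) (r ^ k • (y * op (d α β 0) ^ k)) := by
  rw [envEval, LinearMap.comp_apply, LinearEquiv.coe_coe, envCoords_monomial_tmul,
    Finsupp.lsum_single]
  rfl

theorem envEval_mul_twist (hα : α = r₁ + r₂) (hβ : β = -(r₁ * r₂)) (hr : r₁ ≠ 0) (r : K)
    (z : Env α β) : envEval hα hβ hr r (z * twist α β r) = 0 := by
  induction z using env_induction hα hβ hr with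
  | h0 => simp
  | hadd z z' hz hz' => rw [add_mul, map_add, hz, hz', add_zero]
  | hmon i j k y =>
    rw [tmul_mul_twist, monomial_mul_d, map_sub, map_smul, envEval_monomial_tmul,
      envEval_monomial_tmul, Finsupp.smul_single, smul_smul, mul_assoc, ← pow_succ', ← pow_succ',
      sub_self]

/-- The inclusion into `A ⊗ Aᵒᵖ` of the span of the `uⁱ wʲ ⊗ y`. -/
noncomputable def envIncl (α β r₁ : K) :
    (ℕ × ℕ →₀ (DownUpAlgebra α β 0)ᵐᵒᵖ) →ₗ[K] Env α β :=
  Finsupp.lsum K fun n => TensorProduct.mk K _ _ (monomial α β r₁ (n.1, n.2, 0))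

theorem envIncl_single (i j : ℕ) (y : (DownUpAlgebra α β 0)ᵐᵒᵖ) :
    envIncl α β r₁ (Finsupp.single (i, j) y) = monomial α β r₁ (i, j, 0) ⊗ₜ[K] y := by
  rw [envIncl, Finsupp.lsum_single]
  rfl

/-- Division with remainder by `d ⊗ 1 - r (1 ⊗ d)`. -/
theorem exists_eq_mul_twist_add (hα : α = r₁ + r₂) (hβ : β = -(r₁ * r₂)) (hr : r₁ ≠ 0) (r : K)
    (z : Env α β) : ∃ x y, z = x * twist α β r + envIncl α β r₁ y := by
  induction z using env_induction hα hβ hr with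
  | h0 => exact ⟨0, 0, by simp⟩
  | hadd z z' hz hz' =>
    obtain ⟨x, y, rfl⟩ := hz
    obtain ⟨x', y', rfl⟩ := hz'
    exact ⟨x + x', y + y', by rw [add_mul, map_add]; abel⟩
  | hmon i j k y =>
    induction k generalizing y with
    | zero => exact ⟨0, Finsupp.single (i, j) y, by rw [envIncl_single, zero_mul, zero_add]⟩
    | succ k ih =>
      obtain ⟨x, y', h⟩ := ih (r • (y * op (d α β 0)))
      refine ⟨monomial α β r₁ (i, j, k) ⊗ₜ[K] y + x, y', ?_⟩
      rw [add_mul, tmul_mul_twist, monomial_mul_d, add_assoc, ← h, TensorProduct.tmul_smul]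
      abel

/-- The factorization of `t² - α t - β`, with `d ⊗ 1` and `1 ⊗ d` as the two variables. -/
theorem delta2Gen_ddu_u (hα : α = r₁ + r₂) (hβ : β = -(r₁ * r₂)) :
    delta2Gen α β .ddu .u = twist α β r₁ * twist α β r₂ := by
  have h1 : (op 1 : (DownUpAlgebra α β 0)ᵐᵒᵖ) = 1 := rfl
  simp only [delta2Gen, tri, twist, Pi.sub_apply, Pi.add_apply, Pi.smul_apply, Pi.single_apply,
    reduceCtorEq, if_true, if_false, zero_add, add_zero, mul_sub, sub_mul, smul_mul_assoc,
    mul_smul_comm, Algebra.TensorProduct.tmul_mul_tmul, h1, mul_one, one_mul,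
    MulOpposite.op_mul]
  subst hα hβ
  module

theorem delta2Gen_duu_u :
    delta2Gen α β .duu .u = d α β 0 ⊗ₜ[K] op (u α β 0) + (d α β 0 * u α β 0) ⊗ₜ[K] 1
      - α • (1 ⊗ₜ[K] op (d α β 0 * u α β 0) + (u α β 0 * d α β 0) ⊗ₜ[K] 1)
      - β • (1 ⊗ₜ[K] op (u α β 0 * d α β 0) + u α β 0 ⊗ₜ[K] op (d α β 0)) := by
  have h1 : (op 1 : (DownUpAlgebra α β 0)ᵐᵒᵖ) = 1 := rfl
  simp only [delta2Gen, tri, Pi.sub_apply, Pi.add_apply, Pi.smul_apply, Pi.single_apply,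
    reduceCtorEq, if_true, if_false, zero_add, add_zero, h1]

/-- The leading term of the product is `uⁱ wʲ⁺¹`: the contributions of `uⁱ⁺¹ wʲ` cancel since `r₂`
is a root of `t² - α t - β`. -/
theorem envEval_mul_delta2Gen_duu_u (hα : α = r₁ + r₂) (hβ : β = -(r₁ * r₂)) (hr : r₁ ≠ 0)
    (i j : ℕ) (y : (DownUpAlgebra α β 0)ᵐᵒᵖ) :
    envEval hα hβ hr r₂ (monomial α β r₁ (i, j, 0) ⊗ₜ[K] y * delta2Gen α β .duu .u) =
      Finsupp.single (i, j + 1) (r₁⁻¹ • y) - Finsupp.single (i, j) (y * op (w α β r₁)) := by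
  have hu : monomial α β r₁ (i, j, 0) * u α β 0 = r₁ ^ j • monomial α β r₁ (i + 1, j, 0) := by
    rw [monomial_mul_u hα hβ hr]
    simp [crossCoeff]
  have hdu : monomial α β r₁ (i, j, 0) * (d α β 0 * u α β 0) =
      (r₂ * r₁ ^ j) • monomial α β r₁ (i + 1, j, 1) + r₁⁻¹ • monomial α β r₁ (i, j + 1, 0) := by
    rw [← mul_assoc, monomial_mul_d, monomial_mul_u hα hβ hr]
    simp [crossCoeff]
  have hud : monomial α β r₁ (i, j, 0) * (u α β 0 * d α β 0) =
      r₁ ^ j • monomial α β r₁ (i + 1, j, 1) := by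
    rw [← mul_assoc, hu, smul_mul_assoc, monomial_mul_d]
  rw [delta2Gen_duu_u]
  simp only [mul_add, mul_sub, mul_smul_comm, Algebra.TensorProduct.tmul_mul_tmul, mul_one, hu,
    hdu, hud, monomial_mul_d, zero_add, TensorProduct.add_tmul, ← TensorProduct.smul_tmul',
    map_add, map_sub, map_smul, envEval_monomial_tmul, pow_zero, pow_one, one_smul, w,
    MulOpposite.op_add, MulOpposite.op_smul, MulOpposite.op_mul, ← mul_assoc,
    Finsupp.single_add, ← Finsupp.smul_single]
  subst hα hβ
  module

theorem envEval_envIncl_mul (hα : α = r₁ + r₂) (hβ : β = -(r₁ * r₂)) (hr : r₁ ≠ 0)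
    (y : ℕ × ℕ →₀ (DownUpAlgebra α β 0)ᵐᵒᵖ) (i j : ℕ) :
    envEval hα hβ hr r₂ (envIncl α β r₁ y * delta2Gen α β .duu .u) (i, j + 1) =
      r₁⁻¹ • y (i, j) - y (i, j + 1) * op (w α β r₁) := by
  induction y using Finsupp.induction_linear with
  | zero => simp
  | add y y' h h' =>
    rw [map_add, add_mul, map_add, Finsupp.add_apply, h, h', Finsupp.add_apply,
      Finsupp.add_apply, add_mul, smul_add]
    abel
  | single n y =>
    rw [envIncl_single, envEval_mul_delta2Gen_duu_u, Finsupp.sub_apply]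
    congr 1
    · simp only [Finsupp.single_apply, Prod.ext_iff, Nat.add_right_cancel_iff, smul_ite, smul_zero]
    · simp only [Finsupp.single_apply, ite_mul, zero_mul]

theorem delta2_apply_u (z : DownUpRelWord → Env α β) :
    delta2 α β z .u = z .ddu * delta2Gen α β .ddu .u + z .duu * delta2Gen α β .duu .u := by
  rw [delta2, Fintype.linearCombination_apply,
    show (Finset.univ : Finset DownUpRelWord) = {.ddu, .duu} from rfl,
    Finset.sum_pair (by decide)]
  rfl

theorem delta3_apply_duu (hβ : β = -(r₁ * r₂)) (x : Env α β) :
    delta3 α β x .duu = x * twist α β (r₁ * r₂) := by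
  change x * delta3Gen α β .duu = _
  congr 1
  simp only [delta3Gen, tri, twist, Pi.sub_apply, Pi.add_apply, Pi.smul_apply, Pi.single_apply,
    reduceCtorEq, if_true, if_false, sub_zero, smul_zero, hβ]
  module

theorem delta3_injective (hα : α = r₁ + r₂) (hβ : β = -(r₁ * r₂)) (hr : r₁ ≠ 0) :
    Function.Injective (delta3 α β) := by
  refine (injective_iff_map_eq_zero _).2 fun x hx => ?_
  refine eq_zero_of_mul_twist_eq_zero hα hβ hr (r := r₁ * r₂) ?_
  rw [← delta3_apply_duu hβ, hx]
  rfl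

theorem exact_delta3_delta2 (hα : α = r₁ + r₂) (hβ : β = -(r₁ * r₂)) (hr : r₁ ≠ 0) :
    Function.Exact (delta3 α β) (delta2 α β) := by
  intro z
  refine ⟨fun hz => ?_, ?_⟩
  · obtain ⟨x, y, hxy⟩ := exists_eq_mul_twist_add hα hβ hr (r₁ * r₂) (z .duu)
    -- Subtracting `δ₃ x` leaves a cycle whose second component is the remainder `y`.
    have hduu : (z - delta3 α β x) .duu = envIncl α β r₁ y := by
      rw [Pi.sub_apply, delta3_apply_duu hβ, hxy, add_sub_cancel_left]
    have hcyc : delta2 α β (z - delta3 α β x) = 0 := by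
      rw [map_sub, hz, zero_sub, neg_eq_zero]
      exact LinearMap.congr_fun (delta2_comp_delta3 α β) x
    have hu := congrFun hcyc .u
    rw [delta2_apply_u, hduu, delta2Gen_ddu_u hα hβ, ← mul_assoc, Pi.zero_apply] at hu
    have hy : y = 0 := by
      ext1 ⟨i, j⟩
      rw [Finsupp.zero_apply]
      refine eq_zero_of_eventually_zero_of_succ (f := fun j => y (i, j))
        ⟨y.support.sup (fun n => n.2) + 1, fun k hk => ?_⟩ (fun k hk => ?_) j
      · by_contra h
        have := Finset.le_sup (f := fun n : ℕ × ℕ => n.2) (Finsupp.mem_support_iff.2 h)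
        simp only at this
        omega
      · have h := congrArg (fun e => envEval hα hβ hr r₂ e (i, k + 1)) hu
        simp only [map_add, envEval_mul_twist, zero_add, envEval_envIncl_mul, map_zero,
          Finsupp.zero_apply, hk, zero_mul, sub_zero] at h
        exact (smul_eq_zero.1 h).resolve_left (inv_ne_zero hr)
    rw [hy, map_zero, zero_mul, add_zero] at hu
    have hddu := eq_zero_of_mul_twist_eq_zero hα hβ hr (eq_zero_of_mul_twist_eq_zero hα hβ hr hu)
    refine ⟨x, (sub_eq_zero.1 (funext fun v => ?_)).symm⟩
    cases v
    · exact hddu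
    · rw [hduu, hy, map_zero, Pi.zero_apply]
  · rintro ⟨x, rfl⟩
    exact LinearMap.congr_fun (delta2_comp_delta3 α β) x

end LeftHalf

/-! ### The resolution and the third Hochschild cohomology -/

section Cohomology

variable {α β r₁ r₂ : K}

/-- The identification of the underlying group of the regular bimodule with `A`. -/
noncomputable def regularElem (α β : K) :
    regularBimodule K (DownUpAlgebra α β 0) ≃+ DownUpAlgebra α β 0 :=
  AddEquiv.refl (DownUpAlgebra α β 0)

theorem regularElem_tmul_smul (x y : DownUpAlgebra α β 0)
    (m : regularBimodule K (DownUpAlgebra α β 0)) :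
    regularElem α β ((x ⊗ₜ[K] op y : Env α β) • m) = x * regularElem α β m * y :=
  (TensorProduct.Algebra.smul_def x (op y) (regularElem α β m)).trans (mul_assoc _ _ _).symm

theorem regularElem_bimoduleHomOfElem_tmul (a x y : DownUpAlgebra α β 0) :
    regularElem α β ((bimoduleHomOfElem K a).hom (x ⊗ₜ[K] op y : Env α β)) = x * a * y :=
  regularElem_tmul_smul x y ((regularElem α β).symm a)

theorem regularElem_bimoduleHomOfElem_one (a : DownUpAlgebra α β 0) :
    regularElem α β ((bimoduleHomOfElem K a).hom (1 : Env α β)) = a := by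
  refine (regularElem_bimoduleHomOfElem_tmul a 1 1).trans ?_
  rw [one_mul, mul_one]

theorem regular_hom_ext
    {f g : ModuleCat.of (Env α β) (Env α β) ⟶ regularBimodule K (DownUpAlgebra α β 0)}
    (h : regularElem α β (f.hom (1 : Env α β)) = regularElem α β (g.hom (1 : Env α β))) : f = g :=
  ModuleCat.hom_ext (LinearMap.ext_ring ((regularElem α β).injective h))

theorem koszulAug_quasiIso (hα : α = r₁ + r₂) (hβ : β = -(r₁ * r₂)) (hr : r₁ ≠ 0) :
    QuasiIso (koszulAug α β) where
  quasiIsoAt n := by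
    cases n with
    | zero =>
      rw [ChainComplex.quasiIsoAt₀_iff, ShortComplex.quasiIso_iff_of_zeros' _ rfl rfl rfl]
      have h0 : (koszulAug α β).f 0 = bimoduleHomOfElem K (1 : DownUpAlgebra α β 0) :=
        ChainComplex.toSingle₀Equiv_symm_apply_f_zero _ _
      constructor
      · rw [ShortComplex.moduleCat_exact_iff]
        intro z hz
        obtain ⟨y, hy⟩ := mem_range_delta1_of_mul_eq_zero z
          ((congrArg (fun f => f.hom z) h0).symm.trans hz)
        exact ⟨y, (congrArg (fun f => f.hom y) (koszulComplex_d α β 0)).trans hy⟩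
      · change Epi ((koszulAug α β).f 0)
        rw [h0]
        refine (ModuleCat.epi_iff_surjective _).2 fun m => ?_
        have h := regularElem_bimoduleHomOfElem_tmul 1 (regularElem α β m) 1
        rw [mul_one, mul_one] at h
        exact ⟨regularElem α β m ⊗ₜ[K] op 1, (regularElem α β).injective h⟩
    | succ n =>
      rw [quasiIsoAt_iff_exactAt' (hL := ChainComplex.exactAt_succ_single_obj ..),
        HomologicalComplex.exactAt_iff' _ (n + 2) (n + 1) n (by simp) (by simp),
        ShortComplex.moduleCat_exact_iff]
      change ∀ z, ((koszulComplex α β).d (n + 1) n).hom z = 0 →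
        ∃ y, ((koszulComplex α β).d (n + 1 + 1) (n + 1)).hom y = z
      rw [koszulComplex_d, koszulComplex_d]
      match n with
      | 0 => exact fun z hz => (exact_delta2_delta1 z).1 hz
      | 1 => exact fun z hz => (exact_delta3_delta2 hα hβ hr z).1 hz
      | 2 =>
        exact fun z hz => ⟨0, (map_zero _).trans
          ((injective_iff_map_eq_zero _).1 (delta3_injective hα hβ hr) z hz).symm⟩
      | _ + 3 => exact fun z _ => ⟨0, rfl⟩

theorem bimoduleHomOfElem_add (a b : DownUpAlgebra α β 0) :
    bimoduleHomOfElem K (a + b) = bimoduleHomOfElem K a + bimoduleHomOfElem K b := by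
  refine regular_hom_ext ?_
  rw [ModuleCat.hom_add, LinearMap.add_apply, map_add, regularElem_bimoduleHomOfElem_one,
    regularElem_bimoduleHomOfElem_one, regularElem_bimoduleHomOfElem_one]

theorem bimoduleHomOfElem_smul (c : K) (a : DownUpAlgebra α β 0) :
    bimoduleHomOfElem K (c • a) =
      bimoduleHomOfElem K a ≫ (c • 𝟙 (regularBimodule K (DownUpAlgebra α β 0))) := by
  refine regular_hom_ext ?_
  change _ = regularElem α β
    (algebraMap K (Env α β) c • (bimoduleHomOfElem K a).hom (1 : Env α β))
  rw [Algebra.TensorProduct.algebraMap_apply, ← MulOpposite.op_one, regularElem_tmul_smul,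
    regularElem_bimoduleHomOfElem_one, regularElem_bimoduleHomOfElem_one, mul_one,
    Algebra.smul_def]

/-- The map `a ↦ [D²U² | a]` as a linear map. -/
noncomputable def cohClass3LinearMap (h : QuasiIso (koszulAug α β)) :
    DownUpAlgebra α β 0 →ₗ[K] HochschildCohomology K (DownUpAlgebra α β 0) 3 where
  toFun := cohClass3 α β h
  map_add' a b := by
    simp only [cohClass3, bimoduleHomOfElem_add]
    exact ((koszulResolution α β h).add_extMk _ _ _ _ _ _).symm
  map_smul' c a := by
    simp only [cohClass3, bimoduleHomOfElem_smul, RingHom.id_apply, Abelian.Ext.smul_eq_comp_mk₀]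
    exact ((koszulResolution α β h).extMk_comp_mk₀ _ _ _ _ _).symm

theorem cohClass3LinearMap_surjective (h : QuasiIso (koszulAug α β)) :
    Function.Surjective (cohClass3LinearMap h) := by
  intro x
  obtain ⟨f, hf, rfl⟩ := (koszulResolution α β h).extMk_surjective x 4 rfl
  let f' : ModuleCat.of (Env α β) (Env α β) ⟶ regularBimodule K (DownUpAlgebra α β 0) := f
  have hf' : bimoduleHomOfElem K (regularElem α β (f'.hom (1 : Env α β))) = f' :=
    regular_hom_ext (regularElem_bimoduleHomOfElem_one _)
  refine ⟨regularElem α β (f'.hom (1 : Env α β)), ?_⟩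
  change cohClass3 α β h _ = _
  simp only [cohClass3, hf']
  rfl

theorem regularElem_hom_delta3Gen
    (g : (DownUpRelWord → Env α β) →ₗ[Env α β] regularBimodule K (DownUpAlgebra α β 0))
    {p q : DownUpAlgebra α β 0} (hp : regularElem α β (g (tri 1 .ddu 1)) = p)
    (hq : regularElem α β (g (tri 1 .duu 1)) = q) :
    regularElem α β (g (delta3Gen α β)) =
      d α β 0 * q + β • (q * d α β 0) + -p * u α β 0 + β • (u α β 0 * -p) := by
  have htri (c : K) (x y : DownUpAlgebra α β 0) (v : DownUpRelWord) :
      regularElem α β (g (c • tri x v y)) = c • (x * regularElem α β (g (tri 1 v 1)) * y) := by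
    have : (c • tri x v y : DownUpRelWord → Env α β) =
        ((c • x) ⊗ₜ[K] op y : Env α β) • tri 1 v 1 := by
      rw [← TensorProduct.smul_tmul', smul_assoc, smul_tri, mul_one, one_mul]
    rw [this, map_smul, regularElem_tmul_smul, smul_mul_assoc, smul_mul_assoc]
  have h1 : delta3Gen α β = (1 : K) • tri (d α β 0) .duu 1 + β • tri 1 .duu (d α β 0)
    + (-1 : K) • tri 1 .ddu (u α β 0) + (-β) • tri (u α β 0) .ddu 1 := by
    rw [delta3Gen]
    module
  rw [h1, map_add, map_add, map_add, map_add, map_add, map_add, htri, htri, htri, htri, hp, hq]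
  simp only [mul_one, one_mul, one_smul, neg_smul, neg_mul, mul_neg, smul_neg]

/-- A bimodule map `A ⊗ R ⊗ A → A` is a pair `(p, q)` of elements of `A`, and its composite with
`δ₃` is the coboundary with `a = q` and `a' = -p`. -/
theorem cohClass3_eq_zero_iff (h : QuasiIso (koszulAug α β)) (a : DownUpAlgebra α β 0) :
    cohClass3 α β h a = 0 ↔ a ∈ boundary3 α β := by
  refine ((koszulResolution α β h).extMk_eq_zero_iff _ 4 rfl _ 2 rfl).trans ?_
  change (∃ g, (koszulComplex α β).d 3 2 ≫ g = bimoduleHomOfElem K a) ↔ _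
  rw [koszulComplex_d]
  have key (g : ModuleCat.of (Env α β) (DownUpRelWord → Env α β) ⟶
      regularBimodule K (DownUpAlgebra α β 0)) :
      ModuleCat.ofHom (delta3 α β) ≫ g = bimoduleHomOfElem K a ↔
        regularElem α β (g.hom (delta3Gen α β)) = a := by
    have h1 : (ModuleCat.ofHom (delta3 α β) ≫ g).hom (1 : Env α β) = g.hom (delta3Gen α β) :=
      congrArg g.hom (one_smul (Env α β) (delta3Gen α β))
    rw [← h1]
    refine ⟨fun hg => ?_, fun hg => regular_hom_ext ?_⟩
    · rw [hg, regularElem_bimoduleHomOfElem_one]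
    · rw [hg, regularElem_bimoduleHomOfElem_one]
  constructor
  · rintro ⟨g, hg⟩
    exact ⟨_, _, ((key g).1 hg).symm.trans (regularElem_hom_delta3Gen g.hom rfl rfl)⟩
  · rintro ⟨q, p, ha⟩
    let e : DownUpRelWord → regularBimodule K (DownUpAlgebra α β 0) := fun v => match v with
      | .ddu => (regularElem α β).symm (-p)
      | .duu => (regularElem α β).symm q
    let g : (DownUpRelWord → Env α β) →ₗ[Env α β] regularBimodule K (DownUpAlgebra α β 0) :=
      Fintype.linearCombination (Env α β) e
    have hg (v : DownUpRelWord) : g (tri 1 v 1) = e v :=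
      (Fintype.linearCombination_apply_single ..).trans (one_smul (Env α β) (e v))
    refine ⟨ModuleCat.homEquiv.symm g, (key _).2 ?_⟩
    refine (regularElem_hom_delta3Gen g (p := -p) (q := q) ?_ ?_).trans ?_
    · rw [hg, AddEquiv.apply_symm_apply]
    · rw [hg, AddEquiv.apply_symm_apply]
    · rw [neg_neg, ha]

/-- The isomorphism `A / {da + βad + a'u + βua'} ≅ HH³(A)` induced by `a ↦ [D²U² | a]`. -/
noncomputable def quotientEquivHH3 (h : QuasiIso (koszulAug α β)) :
    (DownUpAlgebra α β 0 ⧸ boundary3 α β) ≃ₗ[K]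
      HochschildCohomology K (DownUpAlgebra α β 0) 3 :=
  Submodule.quotEquivOfEq _ _ (Submodule.ext fun a => (cohClass3_eq_zero_iff h a).symm) ≪≫ₗ
    (cohClass3LinearMap h).quotKerEquivOfSurjective (cohClass3LinearMap_surjective h)

theorem quotientEquivHH3_mk (h : QuasiIso (koszulAug α β)) (a : DownUpAlgebra α β 0) :
    quotientEquivHH3 h (Submodule.Quotient.mk a) = cohClass3 α β h a :=
  rfl

end Cohomology

/-! ### A basis of the quotient by the coboundaries -/

section Quotient

variable {α β r₁ r₂ : K}

theorem IsGradedGeneric.pow_mul_pow_ne (h : IsGradedGeneric α β r₁ r₂) {i j : ℕ}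
    (hij : ¬(i = 1 ∧ j = 1)) : r₂ ^ i * r₁ ^ j - r₁ * r₂ ≠ 0 := by
  intro h0
  refine h.2.2.2 (j - 1) (i - 1) (fun hc => hij ?_) ?_
  · simp only [Prod.mk.injEq] at hc
    omega
  · have h1 := h.2.1
    have h2 := h.2.2.1
    rw [zpow_sub_one₀ h1, zpow_sub_one₀ h2, zpow_natCast, zpow_natCast]
    field_simp
    linear_combination h0

theorem d_mul_monomial_add (hα : α = r₁ + r₂) (hβ : β = -(r₁ * r₂)) (hr : r₁ ≠ 0) (i j k : ℕ) :
    d α β 0 * monomial α β r₁ (i, j, k) + β • (monomial α β r₁ (i, j, k) * d α β 0) =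
      (r₂ ^ i * r₁ ^ j - r₁ * r₂) • monomial α β r₁ (i, j, k + 1)
        + crossCoeff r₁ r₂ i • monomial α β r₁ (i - 1, j + 1, k) := by
  rw [d_mul_monomial hα hβ hr, monomial_mul_d]
  subst hβ
  module

theorem monomial_mul_u_add (hα : α = r₁ + r₂) (hβ : β = -(r₁ * r₂)) (hr : r₁ ≠ 0) (i j k : ℕ) :
    monomial α β r₁ (i, j, k) * u α β 0 + β • (u α β 0 * monomial α β r₁ (i, j, k)) =
      (r₂ ^ k * r₁ ^ j - r₁ * r₂) • monomial α β r₁ (i + 1, j, k)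
        + crossCoeff r₁ r₂ k • monomial α β r₁ (i, j + 1, k - 1) := by
  rw [monomial_mul_u hα hβ hr, u_mul_monomial]
  subst hβ
  module

/-- The class of `uⁱ wʲ dⁱ` in the quotient by the coboundaries, in terms of the classes of `wⁿ`,
`n ≠ 2`, and of `u w d`. The denominator vanishes only for `u w d` itself, which is a separate
case. -/
noncomputable def diagCoords (r₁ r₂ : K) : ℕ → ℕ → ({j : ℕ // j ≠ 2} ⊕ Unit →₀ K)
  | 0, j => if h : j ≠ 2 then Finsupp.single (Sum.inl ⟨j, h⟩) 1 else 0
  | i + 1, j => if i = 0 ∧ j = 1 then Finsupp.single (Sum.inr ()) 1 else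
      (-crossCoeff r₁ r₂ (i + 1) / (r₂ ^ (i + 1) * r₁ ^ j - r₁ * r₂)) • diagCoords r₁ r₂ i (j + 1)

/-- For `i = 0`, `j = 1` both terms vanish: the first coefficient is zero, and so is the class of
`w²`. -/
theorem diagCoords_rel (h : IsGradedGeneric α β r₁ r₂) (i j : ℕ) :
    (r₂ ^ (i + 1) * r₁ ^ j - r₁ * r₂) • diagCoords r₁ r₂ (i + 1) j
      + crossCoeff r₁ r₂ (i + 1) • diagCoords r₁ r₂ i (j + 1) = 0 := by
  rw [diagCoords]
  split_ifs with hij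
  · obtain ⟨rfl, rfl⟩ := hij
    simp [diagCoords, mul_comm r₁ r₂]
  · rw [smul_smul, mul_div_cancel₀ _ (h.pow_mul_pow_ne (by omega))]
    module

/-- The coordinates of the class of an element in the quotient by the coboundaries. -/
noncomputable def quotientCoords (hα : α = r₁ + r₂) (hβ : β = -(r₁ * r₂)) (hr : r₁ ≠ 0) :
    DownUpAlgebra α β 0 →ₗ[K] ({j : ℕ // j ≠ 2} ⊕ Unit →₀ K) :=
  (monomialBasis hα hβ hr).constr K fun n => if n.1 = n.2.2 then diagCoords r₁ r₂ n.1 n.2.1 else 0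

theorem quotientCoords_monomial (hα : α = r₁ + r₂) (hβ : β = -(r₁ * r₂)) (hr : r₁ ≠ 0)
    (i j k : ℕ) : quotientCoords hα hβ hr (monomial α β r₁ (i, j, k)) =
      if i = k then diagCoords r₁ r₂ i j else 0 := by
  rw [← monomialBasis_apply hα hβ hr, quotientCoords, Module.Basis.constr_basis]

theorem boundary3_le_ker (h : IsGradedGeneric α β r₁ r₂) (hα : α = r₁ + r₂)
    (hβ : β = -(r₁ * r₂)) (hr : r₁ ≠ 0) :
    boundary3 α β ≤ LinearMap.ker (quotientCoords hα hβ hr) := by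
  have hd : quotientCoords hα hβ hr ∘ₗ
      (LinearMap.mulLeft K (d α β 0) + β • LinearMap.mulRight K (d α β 0)) = 0 := by
    refine (monomialBasis hα hβ hr).ext fun ⟨i, j, k⟩ => ?_
    rw [monomialBasis_apply]
    change quotientCoords hα hβ hr (d α β 0 * _ + β • (_ * d α β 0)) = 0
    rw [d_mul_monomial_add hα hβ hr, map_add, map_smul, map_smul, quotientCoords_monomial,
      quotientCoords_monomial]
    cases i with
    | zero => simp [crossCoeff]
    | succ i =>
      rw [Nat.add_sub_cancel]
      by_cases hik : i = k
      · subst hik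
        rw [if_pos rfl, if_pos rfl, diagCoords_rel h]
      · rw [if_neg (by omega), if_neg hik, smul_zero, smul_zero, add_zero]
  have hu : quotientCoords hα hβ hr ∘ₗ
      (LinearMap.mulRight K (u α β 0) + β • LinearMap.mulLeft K (u α β 0)) = 0 := by
    refine (monomialBasis hα hβ hr).ext fun ⟨i, j, k⟩ => ?_
    rw [monomialBasis_apply]
    change quotientCoords hα hβ hr (_ * u α β 0 + β • (u α β 0 * _)) = 0
    rw [monomial_mul_u_add hα hβ hr, map_add, map_smul, map_smul, quotientCoords_monomial,
      quotientCoords_monomial]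
    cases k with
    | zero => simp [crossCoeff]
    | succ k =>
      rw [Nat.add_sub_cancel]
      by_cases hik : i = k
      · subst hik
        rw [if_pos rfl, if_pos rfl, diagCoords_rel h]
      · rw [if_neg (by omega), if_neg hik, smul_zero, smul_zero, add_zero]
  rintro _ ⟨a, a', rfl⟩
  rw [LinearMap.mem_ker, add_assoc, map_add]
  exact (congrArg₂ (· + ·) (LinearMap.congr_fun hd a) (LinearMap.congr_fun hu a')).trans
    (add_zero _)

/-- The classes of `wʲ`, `j ≠ 2`, and of `u w d` in the quotient by the coboundaries. -/
noncomputable def quotientFamily (α β r₁ : K) :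
    {j : ℕ // j ≠ 2} ⊕ Unit → DownUpAlgebra α β 0 ⧸ boundary3 α β
  | .inl j => Submodule.Quotient.mk (w α β r₁ ^ (j : ℕ))
  | .inr _ => Submodule.Quotient.mk (u α β 0 * w α β r₁ * d α β 0)

theorem linearIndependent_quotientFamily (h : IsGradedGeneric α β r₁ r₂) :
    LinearIndependent K (quotientFamily α β r₁) := by
  have hα := h.add_eq
  have hβ := h.mul_eq
  have hr := h.2.1
  refine LinearIndependent.of_comp
    ((boundary3 α β).liftQ (quotientCoords hα hβ hr) (boundary3_le_ker h hα hβ hr)) ?_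
  suffices key : ⇑((boundary3 α β).liftQ (quotientCoords hα hβ hr) (boundary3_le_ker h hα hβ hr)) ∘
      quotientFamily α β r₁ = fun x => Finsupp.single x 1 by
    rw [key]
    exact Finsupp.linearIndependent_single_one K _
  funext x
  rcases x with ⟨j, hj⟩ | ⟨⟩
  · have hm : w α β r₁ ^ j = monomial α β r₁ (0, j, 0) := by simp [monomial]
    change quotientCoords hα hβ hr (w α β r₁ ^ j) = _
    rw [hm, quotientCoords_monomial, if_pos rfl, diagCoords, dif_pos hj]
  · have hm : u α β 0 * w α β r₁ * d α β 0 = monomial α β r₁ (1, 1, 1) := by simp [monomial]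
    change quotientCoords hα hβ hr (u α β 0 * w α β r₁ * d α β 0) = _
    rw [hm, quotientCoords_monomial, if_pos rfl, diagCoords, if_pos ⟨rfl, rfl⟩]

/-- The relation in the quotient coming from `a = uⁱ wʲ dᵏ`, `a' = 0`. -/
theorem d_rel (hα : α = r₁ + r₂) (hβ : β = -(r₁ * r₂)) (hr : r₁ ≠ 0) (i j k : ℕ) :
    (r₂ ^ i * r₁ ^ j - r₁ * r₂) • (boundary3 α β).mkQ (monomial α β r₁ (i, j, k + 1))
      + crossCoeff r₁ r₂ i • (boundary3 α β).mkQ (monomial α β r₁ (i - 1, j + 1, k)) = 0 := by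
  rw [← map_smul, ← map_smul, ← map_add, ← d_mul_monomial_add hα hβ hr, Submodule.mkQ_apply,
    Submodule.Quotient.mk_eq_zero]
  exact ⟨monomial α β r₁ (i, j, k), 0, by simp⟩

/-- The relation in the quotient coming from `a = 0`, `a' = uⁱ wʲ dᵏ`. -/
theorem u_rel (hα : α = r₁ + r₂) (hβ : β = -(r₁ * r₂)) (hr : r₁ ≠ 0) (i j k : ℕ) :
    (r₂ ^ k * r₁ ^ j - r₁ * r₂) • (boundary3 α β).mkQ (monomial α β r₁ (i + 1, j, k))
      + crossCoeff r₁ r₂ k • (boundary3 α β).mkQ (monomial α β r₁ (i, j + 1, k - 1)) = 0 := by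
  rw [← map_smul, ← map_smul, ← map_add, ← monomial_mul_u_add hα hβ hr, Submodule.mkQ_apply,
    Submodule.Quotient.mk_eq_zero]
  exact ⟨0, monomial α β r₁ (i, j, k), by simp⟩

theorem mem_of_smul_add_smul_eq_zero {M : Type*} [AddCommGroup M] [Module K M]
    {S : Submodule K M} {x y : M} {a b : K} (h : a • x + b • y = 0) (ha : a ≠ 0) (hy : y ∈ S) :
    x ∈ S := by
  rw [add_eq_zero_iff_eq_neg] at h
  exact (S.smul_mem_iff ha).1 (h ▸ S.neg_mem (S.smul_mem b hy))

theorem monomial_mem_span_quotientFamily (h : IsGradedGeneric α β r₁ r₂) (i j k : ℕ) :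
    (boundary3 α β).mkQ (monomial α β r₁ (i, j, k)) ∈
      Submodule.span K (Set.range (quotientFamily α β r₁)) := by
  have hα := h.add_eq
  have hβ := h.mul_eq
  have hr := h.2.1
  induction i generalizing j k with
  | zero =>
    cases k with
    | zero =>
      have hm : monomial α β r₁ (0, j, 0) = w α β r₁ ^ j := by simp [monomial]
      by_cases hj : j = 2
      · -- The relation given by `u w` has zero leading coefficient, so that `w²` is a coboundary.
        have hd := d_rel hα hβ hr 1 1 0
        rw [pow_one, pow_one, mul_comm r₂, sub_self, zero_smul, zero_add] at hd
        subst hj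
        exact (smul_eq_zero.1 hd).resolve_left (by simpa [crossCoeff] using hr) ▸ zero_mem _
      · rw [hm]
        exact Submodule.subset_span ⟨.inl ⟨j, hj⟩, rfl⟩
    | succ k =>
      have hd := d_rel hα hβ hr 0 j k
      rw [crossCoeff, zero_smul, add_zero] at hd
      exact (smul_eq_zero.1 hd).resolve_left (h.pow_mul_pow_ne (by omega)) ▸ zero_mem _
  | succ i ih =>
    cases k with
    | zero =>
      have hu := u_rel hα hβ hr i j 0
      rw [crossCoeff, zero_smul, add_zero] at hu
      exact (smul_eq_zero.1 hu).resolve_left (h.pow_mul_pow_ne (by omega)) ▸ zero_mem _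
    | succ k =>
      by_cases hij : i = 0 ∧ j = 1
      · obtain ⟨rfl, rfl⟩ := hij
        by_cases hk : k = 0
        · subst hk
          have hm : monomial α β r₁ (0 + 1, 1, 0 + 1) = u α β 0 * w α β r₁ * d α β 0 := by
            simp [monomial]
          rw [hm]
          exact Submodule.subset_span ⟨.inr (), rfl⟩
        · exact mem_of_smul_add_smul_eq_zero (u_rel hα hβ hr 0 1 (k + 1))
            (h.pow_mul_pow_ne (by omega)) (ih _ _)
      · exact mem_of_smul_add_smul_eq_zero (d_rel hα hβ hr (i + 1) j k)
          (h.pow_mul_pow_ne (by omega)) (ih _ _)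

/-- The basis of the quotient by the coboundaries given by `quotientFamily`. -/
noncomputable def quotientBasis (h : IsGradedGeneric α β r₁ r₂) :
    Module.Basis ({j : ℕ // j ≠ 2} ⊕ Unit) K (DownUpAlgebra α β 0 ⧸ boundary3 α β) :=
  Module.Basis.mk (linearIndependent_quotientFamily h) (by
    have hle : ⊤ ≤ (Submodule.span K (Set.range (quotientFamily α β r₁))).comap
        (boundary3 α β).mkQ := by
      rw [← (monomialBasis h.add_eq h.mul_eq h.2.1).span_eq, Submodule.span_le]
      rintro _ ⟨n, rfl⟩
      rw [monomialBasis_apply]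
      exact monomial_mem_span_quotientFamily h n.1 n.2.1 n.2.2
    rintro x -
    obtain ⟨a, rfl⟩ := (boundary3 α β).mkQ_surjective x
    exact hle Submodule.mem_top)

end Quotient
end DownUpAlgebra

theorem proposition4p2 {K : Type u} [Field K] [CharZero K] (α β r₁ r₂ : K)
    (hF1 : DownUpAlgebra.IsGradedGeneric α β r₁ r₂) :
    ∃ h : QuasiIso (DownUpAlgebra.koszulAug α β),
      (∃ e : (DownUpAlgebra α β 0 ⧸ DownUpAlgebra.boundary3 α β) ≃ₗ[K]
          HochschildCohomology K (DownUpAlgebra α β 0) 3,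
        ∀ a : DownUpAlgebra α β 0,
          e (Submodule.Quotient.mk a) = DownUpAlgebra.cohClass3 α β h a) ∧
      ∃ b : Module.Basis ({j : ℕ // j ≠ 2} ⊕ Unit) K
          (HochschildCohomology K (DownUpAlgebra α β 0) 3),
        (∀ j : {j : ℕ // j ≠ 2}, b (Sum.inl j) =
          DownUpAlgebra.cohClass3 α β h (DownUpAlgebra.w α β r₁ ^ (j : ℕ))) ∧
        b (Sum.inr ()) = DownUpAlgebra.cohClass3 α β h
          (DownUpAlgebra.u α β 0 * DownUpAlgebra.w α β r₁ * DownUpAlgebra.d α β 0) := by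
  have h := DownUpAlgebra.koszulAug_quasiIso hF1.add_eq hF1.mul_eq hF1.2.1
  refine ⟨h, ⟨DownUpAlgebra.quotientEquivHH3 h, DownUpAlgebra.quotientEquivHH3_mk h⟩,
    (DownUpAlgebra.quotientBasis hF1).map (DownUpAlgebra.quotientEquivHH3 h), fun j => ?_, ?_⟩
  · rw [Module.Basis.map_apply, DownUpAlgebra.quotientBasis, Module.Basis.mk_apply]
    exact DownUpAlgebra.quotientEquivHH3_mk h _
  · rw [Module.Basis.map_apply, DownUpAlgebra.quotientBasis, Module.Basis.mk_apply]
    exact DownUpAlgebra.quotientEquivHH3_mk h _
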